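/- Let $\ell\ge 2$ be an even integer, $c_1\in\mathbb R$, and let $f:\mathbb R\to\mathbb R$, $f(x)=x^\ell+c_1$, with critical point $c=0$. Let $W=[-w,w]$, $w>0$, have nice boundary points, i.e. $f^n(w)\notin(-w,w)$ for all $n\ge 1$. For a closed symmetric interval $I$, let $R_I$ be the first return map to $I$. Its domain consists of the interior points of $I$ that have a neighbourhood mapped into $I$ by some $f^n$, $n\ge 1$. Its central domain is the closure of the component of this set containing $c$. On the central domain $R_I=f^{n}$, where $n\ge1$ is the least integer such that $f^n$ maps a neighbourhood of $c$ into $I$. A *periodic interval of period $m$* is a non-empty closed symmetric interval $I$ that is its own central domain, with $R_I=f^m$ on it; $f$ is *renormalizable of period $m$*, $m\ge 2$, if there is a periodic interval of period $m$ of the form $[-a,a]$, $a>0$, with nice boundary points. Let $V$ be the central domain of $R_W$ and $U$ the central domain of $R_V$. Assume that $R_W$ has a high return, i.e. $c\in R_W(V)$, that $U=V$ is a periodic interval of period $s$, and that $f$ is not renormalizable of period $s/2$ (a void condition if $s$ is odd). Let $\hat U\supset f(U)$ be the interval mapped monotonically onto $V$ by $f^{s-1}$. Let $l$ be either of the two maximal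 intervals outside $\hat U$ (i.e. disjoint from the interior of $\hat U$) that have exactly one point in common with $\hat U$ and on which $f^s$ is monotone, and put $L=f^s(l)$. Then $$|L|\ \ge\ 0.6\cdot|f(V)|,$$ where $|\cdot|$ denotes length, and $|L|=\infty$ is allowed. -/

import Mathlib

open Set Filter Topology MeasureTheory

noncomputable section

/-- The real unimodal map `x ↦ x ^ ℓ + c₁`, with critical point `c = 0` and critical value `c₁`. -/
def unimodalMap (ℓ : ℕ) (c₁ : ℝ) : ℝ → ℝ := fun x => x ^ ℓ + c₁

/-- The symmetric interval `[-w, w]`, `w > 0`, has nice boundary points: no forward iterate of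
a boundary point lies in the interior (for an even map both boundary points have the
same forward iterates). -/
def HasNiceBoundary (f : ℝ → ℝ) (w : ℝ) : Prop :=
  0 < w ∧ ∀ n : ℕ, 1 ≤ n → f^[n] w ∉ Ioo (-w) w

/-- The points inside `W` around which the first return map to `W` is defined:
some iterate `f^n`, `n ≥ 1`, maps a neighbourhood of the point into `W`. Neighbourhoods are used
because `W` is closed: otherwise distinct branches that share an endpoint would be glued. -/
def returnSet (f : ℝ → ℝ) (W : Set ℝ) : Set ℝ :=
  {x | x ∈ interior W ∧ ∃ n : ℕ, 1 ≤ n ∧ f^[n] ⁻¹' W ∈ 𝓝 x}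

/-- The (closed) central domain of the first return map to `W`: the component of its domain that
contains the critical point `0`. It is empty if the critical point is not in the domain. -/
def centralDomain (f : ℝ → ℝ) (W : Set ℝ) : Set ℝ :=
  closure (connectedComponentIn (returnSet f W) 0)

/-- The return time of the central domain: the first return map to `W` equals
`f^n` on the central domain, with `n = centralTime f W`. -/
def centralTime (f : ℝ → ℝ) (W : Set ℝ) : ℕ :=
  sInf {n : ℕ | 1 ≤ n ∧ f^[n] ⁻¹' W ∈ 𝓝 (0 : ℝ)}

/-- The first return map to `W` has a high return: the image of its central domain contains
the critical point. -/
def HasHighReturn (f : ℝ → ℝ) (W : Set ℝ) : Prop :=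
  (0 : ℝ) ∈ f^[centralTime f W] '' centralDomain f W

/-- `V` is a periodic interval of period `s`: the central domain of the first return map to `V`
is `V` itself, with return time `s`. -/
def IsPeriodicInterval (f : ℝ → ℝ) (V : Set ℝ) (s : ℕ) : Prop :=
  V.Nonempty ∧ centralDomain f V = V ∧ centralTime f V = s

/-- `f` is renormalizable of period `m ≥ 2`: there is a symmetric periodic interval of period `m`
with nice boundary points. -/
def IsRenormalizable (f : ℝ → ℝ) (m : ℕ) : Prop :=
  2 ≤ m ∧ ∃ a : ℝ, HasNiceBoundary f a ∧ IsPeriodicInterval f (Icc (-a) a) m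

/-- `g` is monotone (increasing or decreasing) on `A`. -/
def IsMonotoneOn (g : ℝ → ℝ) (A : Set ℝ) : Prop :=
  MonotoneOn g A ∨ AntitoneOn g A

/-- `Uhat` is the interval containing `f(U)` that `f^(s-1)` maps monotonically onto `V`. -/
def IsMonotonePullback (f : ℝ → ℝ) (s : ℕ) (V U Uhat : Set ℝ) : Prop :=
  Uhat.OrdConnected ∧ f '' U ⊆ Uhat ∧ IsMonotoneOn f^[s - 1] Uhat ∧ f^[s - 1] '' Uhat = V

/-- `l` is a maximal interval outside `K` on which `g` is monotone and which has a unique common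
point with the closed interval `K`. -/
def IsAdjacentMonotone (g : ℝ → ℝ) (K l : Set ℝ) : Prop :=
  Maximal (fun A : Set ℝ =>
    A.OrdConnected ∧ IsMonotoneOn g A ∧ Disjoint A (interior K) ∧ ∃ p, A ∩ K = {p}) l

end

/-!
The map `f` is even and unimodal, and its iterates expand the cross-ratio `|J| |T| / (|L| |R|)` on
every interval without turning points (`EvenUnimodal.crossRatio_iterate`). For power maps this comes
from an elementary inequality for the kernel `∑ x ^ i y ^ (n - 1 - i)`; no distortion bounds are
needed.

Write `V = [-v, v]`. The images `f^i [0, v]`, `1 ≤ i ≤ s`, form a cycle of intervals with disjoint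
interiors, of which `f V = [f 0, f v]` is the leftmost, and a high return of `W` provides a point
`h` of `[0, v]` with `f^s h = 0` (`PeriodicCycle`, `EvenUnimodal.periodicCycle`). The return map
`f^s` is monotone from `f h` to the next preimage of `0` of order `j < s - 1` on either side of
`Uhat`. It takes the value `f v` at the boundary of `Uhat` and the value `f^(k+1) 0`, with `k = s - 1 - j`,
at that preimage. Hence the theorem follows from `PeriodicCycle.le_gap`: the interval `[f v,
f^(k+1) 0]` is at least `0.6` times as long as `f V`. If there is no such preimage, `L` is
unbounded.

For `le_gap`, let `f^m [0, v]` be the shortest interval of the cycle, of length `μ`, and consider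
the maximal branch of `f^(m-1)` around `f V`, cut at `f^(k+1) 0` on the right if it reaches so far.
If the gap were too short, the cross-ratio of the four points involved would exceed `5 / 3`, and by
expansion the two neighbours of `f^m [0, v]` in the image would have lengths `R` and `A` with `5 R A
< 3 μ (μ + R + A)` (`PeriodicCycle.gap_lt`). The neighbours contain intervals of the cycle,
each of length at least `μ` (`PeriodicCycle.card_mul_le`), and in most configurations there are so
many of them that this is impossible. In the remaining ones either a second cross-ratio, on a
smaller branch, gives the contradiction (`PeriodicCycle.nested_contradiction`), or `s = 2 * n` and
`f^(n-1)` has no turning point between the critical value and `f^(n+1) h`.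

This last configuration makes `f` renormalizable of period `n` (`PeriodicCycle.isRenormalizable`).
Up to the sign `ε` of `f^n 0`, the iterate `f^n` is a map `F` that decreases from `F 0` until it
crosses the line `y = -x` at the first point `a`. Then `f^n` maps `[-a, a]` into itself, the images
`f^m [0, v]` with `1 ≤ m < n` avoid `(-a, a)`, and the boundary of `[-a, a]` is nice: two fixed
points of `F` on one orbit have the same multiplier, so `F` cannot increase at one and decrease at
the other.
-/

/-! ### Even unimodal maps and the expansion of cross-ratios -/

/-- Even unimodal maps of the line with minimum at `0` that expand cross-ratios on the half line:
the properties of `x ↦ x ^ ℓ + c₁` on which the argument rests. -/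
structure EvenUnimodal (f : ℝ → ℝ) : Prop where
  cont : Continuous f
  even : ∀ x, f (-x) = f x
  mono : StrictMonoOn f (Ici 0)
  tendsto : Tendsto f atTop atTop
  cross : ∀ a b c d : ℝ, 0 ≤ a → a < b → b < c → c < d →
    (c - b) * (d - a) * ((f b - f a) * (f d - f c)) ≤
      (f c - f b) * (f d - f a) * ((b - a) * (d - c))
  diff : ∀ x, x ≠ 0 → ∃ d, d ≠ 0 ∧ HasDerivAt f d x

/-- The kernel `∑ x ^ i * y ^ (n - 1 - i)` is reverse rule of order two on the half line. -/
theorem geom_sum₂_mul_le {a b c d : ℝ} (n : ℕ) (ha : 0 ≤ a) (hac : a ≤ c) (hb : 0 ≤ b)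
    (hbd : b ≤ d) :
    (∑ i ∈ Finset.range n, c ^ i * d ^ (n - 1 - i)) *
        (∑ i ∈ Finset.range n, a ^ i * b ^ (n - 1 - i)) ≤
      (∑ i ∈ Finset.range n, a ^ i * d ^ (n - 1 - i)) *
        (∑ i ∈ Finset.range n, c ^ i * b ^ (n - 1 - i)) := by
  have key : 0 ≤ ∑ i ∈ Finset.range n, ∑ j ∈ Finset.range n,
      (d ^ (n - 1 - i) * b ^ (n - 1 - j) - d ^ (n - 1 - j) * b ^ (n - 1 - i)) *
        (a ^ i * c ^ j - c ^ i * a ^ j) := by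
    have aux : ∀ i j : ℕ, i ≤ j → j < n →
        0 ≤ (d ^ (n - 1 - i) * b ^ (n - 1 - j) - d ^ (n - 1 - j) * b ^ (n - 1 - i)) *
          (a ^ i * c ^ j - c ^ i * a ^ j) := by
      intro i j hij hj
      obtain ⟨e, rfl⟩ := Nat.exists_eq_add_of_le hij
      have h1 : n - 1 - i = (n - 1 - (i + e)) + e := by omega
      rw [h1, pow_add, pow_add, pow_add, pow_add]
      have hd : 0 ≤ d := hb.trans hbd
      have hc : 0 ≤ c := ha.trans hac
      have h2 : a ^ e ≤ c ^ e := pow_le_pow_left₀ ha hac e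
      have h3 : b ^ e ≤ d ^ e := pow_le_pow_left₀ hb hbd e
      apply mul_nonneg
      · have : 0 ≤ d ^ (n - 1 - (i + e)) * b ^ (n - 1 - (i + e)) * (d ^ e - b ^ e) :=
          mul_nonneg (by positivity) (by linarith)
        nlinarith [this]
      · have : 0 ≤ a ^ i * c ^ i * (c ^ e - a ^ e) := mul_nonneg (by positivity) (by linarith)
        nlinarith [this]
    refine Finset.sum_nonneg fun i hi => Finset.sum_nonneg fun j hj => ?_
    rw [Finset.mem_range] at hi hj
    rcases le_total i j with h | h
    · exact aux i j h hj
    · have := aux j i h hi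
      nlinarith [this]
  have e1 : ∀ x y z t : ℝ, (∑ i ∈ Finset.range n, x ^ i * y ^ (n - 1 - i)) *
      (∑ i ∈ Finset.range n, z ^ i * t ^ (n - 1 - i)) =
      ∑ i ∈ Finset.range n, ∑ j ∈ Finset.range n,
        x ^ i * y ^ (n - 1 - i) * (z ^ j * t ^ (n - 1 - j)) := fun x y z t =>
    Finset.sum_mul_sum _ _ _ _
  have e2 : ∑ i ∈ Finset.range n, ∑ j ∈ Finset.range n,
      (d ^ (n - 1 - i) * b ^ (n - 1 - j) - d ^ (n - 1 - j) * b ^ (n - 1 - i)) *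
        (a ^ i * c ^ j - c ^ i * a ^ j) =
      (∑ i ∈ Finset.range n, a ^ i * d ^ (n - 1 - i)) *
        (∑ i ∈ Finset.range n, c ^ i * b ^ (n - 1 - i)) -
      (∑ i ∈ Finset.range n, c ^ i * d ^ (n - 1 - i)) *
        (∑ i ∈ Finset.range n, a ^ i * b ^ (n - 1 - i)) +
      ((∑ i ∈ Finset.range n, c ^ i * b ^ (n - 1 - i)) *
        (∑ i ∈ Finset.range n, a ^ i * d ^ (n - 1 - i)) -
      (∑ i ∈ Finset.range n, a ^ i * b ^ (n - 1 - i)) *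
        (∑ i ∈ Finset.range n, c ^ i * d ^ (n - 1 - i))) := by
    simp only [e1, ← Finset.sum_sub_distrib, ← Finset.sum_add_distrib]
    exact Finset.sum_congr rfl fun i _ => Finset.sum_congr rfl fun j _ => by ring
  rw [e2] at key
  nlinarith [key]

theorem evenUnimodal_unimodalMap {ℓ : ℕ} (hℓ : 2 ≤ ℓ) (he : Even ℓ) (c₁ : ℝ) :
    EvenUnimodal (unimodalMap ℓ c₁) where
  cont := by unfold unimodalMap; fun_prop
  even x := by simp [unimodalMap, he.neg_pow]
  mono := by
    intro x hx y _ hxy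
    have : x ^ ℓ < y ^ ℓ := pow_lt_pow_left₀ hxy hx (by omega)
    simpa [unimodalMap] using this
  tendsto := by
    unfold unimodalMap
    exact tendsto_atTop_add_const_right _ _ (tendsto_pow_atTop (by omega))
  cross a b c d ha hab hbc hcd := by
    have g : ∀ x y : ℝ, unimodalMap ℓ c₁ x - unimodalMap ℓ c₁ y =
        (∑ i ∈ Finset.range ℓ, x ^ i * y ^ (ℓ - 1 - i)) * (x - y) := fun x y => by
      rw [(Commute.all x y).geom_sum₂_mul]; simp [unimodalMap]
    have sym : ∀ x y : ℝ, (∑ i ∈ Finset.range ℓ, x ^ i * y ^ (ℓ - 1 - i)) * (x - y) =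
        (∑ i ∈ Finset.range ℓ, y ^ i * x ^ (ℓ - 1 - i)) * (x - y) := fun x y => by
      have h1 := (Commute.all x y).geom_sum₂_mul ℓ
      have h2 := (Commute.all y x).geom_sum₂_mul ℓ
      linear_combination h1 + h2
    -- after division by the lengths in the domain, this is the inequality for the kernel
    have key := geom_sum₂_mul_le (a := a) (b := b) (c := c) (d := d) ℓ ha (by linarith)
      (by linarith) (by linarith)
    rw [g b a, g d c, g c b, g d a, sym b a, sym d c, sym d a]
    have hp : 0 ≤ (b - a) * (d - c) * ((c - b) * (d - a)) := by
      have := sub_pos.2 hab; have := sub_pos.2 hcd; have := sub_pos.2 hbc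
      have : 0 < d - a := by linarith
      positivity
    nlinarith [mul_le_mul_of_nonneg_left key hp]
  diff x hx := by
    refine ⟨(ℓ : ℝ) * x ^ (ℓ - 1), mul_ne_zero (by positivity) (pow_ne_zero _ hx), ?_⟩
    exact (hasDerivAt_pow ℓ x).add_const c₁

/-! ### Branches without turning points -/

/-- No point of `(a, b)` reaches the critical point `0` in fewer than `n` steps; equivalently,
`f^n` has no turning point in `(a, b)`. -/
def CritFree (f : ℝ → ℝ) (n : ℕ) (a b : ℝ) : Prop :=
  ∀ i < n, ∀ x ∈ Ioo a b, f^[i] x ≠ 0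

theorem CritFree.mono {f : ℝ → ℝ} {n m : ℕ} {a b a' b' : ℝ} (h : CritFree f n a b)
    (hm : m ≤ n) (ha : a ≤ a') (hb : b' ≤ b) : CritFree f m a' b' :=
  fun i hi x hx => h i (hi.trans_le hm) x ⟨ha.trans_lt hx.1, hx.2.trans_le hb⟩

/-- The cross-ratio `|J| |T| / (|L| |R|)` of four points, with `J` the middle interval, `T` the hull
and `L`, `R` the outer intervals. -/
noncomputable def crossRatio (a b c d : ℝ) : ℝ :=
  |c - b| * |d - a| / (|b - a| * |d - c|)

theorem crossRatio_reverse (a b c d : ℝ) : crossRatio d c b a = crossRatio a b c d := by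
  unfold crossRatio
  rw [abs_sub_comm b c, abs_sub_comm a d, abs_sub_comm c d, abs_sub_comm a b, mul_comm |d - c|]

theorem crossRatio_neg (a b c d : ℝ) : crossRatio (-a) (-b) (-c) (-d) = crossRatio a b c d := by
  have h : ∀ x y : ℝ, |-x - -y| = |x - y| := fun x y => by rw [abs_sub_comm]; congr 1; ring
  unfold crossRatio
  rw [h, h, h, h]

namespace EvenUnimodal
variable {f : ℝ → ℝ}

theorem anti (hf : EvenUnimodal f) : StrictAntiOn f (Iic 0) := by
  intro x hx y hy hxy
  rw [← hf.even x, ← hf.even y]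
  simp only [mem_Iic] at hx hy
  exact hf.mono (mem_Ici.2 (by linarith)) (mem_Ici.2 (by linarith)) (by linarith)

theorem abs (hf : EvenUnimodal f) (x : ℝ) : f |x| = f x := by
  rcases abs_choice x with h | h <;> rw [h]
  exact hf.even x

theorem lt_iff (hf : EvenUnimodal f) (x y : ℝ) : f x < f y ↔ |x| < |y| := by
  rw [← hf.abs x, ← hf.abs y]
  exact hf.mono.lt_iff_lt (abs_nonneg x) (abs_nonneg y)

theorem eq_iff (hf : EvenUnimodal f) (x y : ℝ) : f x = f y ↔ |x| = |y| := by
  rw [← hf.abs x, ← hf.abs y]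
  exact hf.mono.injOn.eq_iff (abs_nonneg x) (abs_nonneg y)

theorem min_le (hf : EvenUnimodal f) (x : ℝ) : f 0 ≤ f x := by
  by_contra h
  have := (hf.lt_iff x 0).1 (not_le.1 h)
  simp at this
  exact absurd this (not_lt.2 (abs_nonneg x))

theorem iterate_cont (hf : EvenUnimodal f) (n : ℕ) : Continuous f^[n] := hf.cont.iterate n

theorem iterate_even (hf : EvenUnimodal f) {n : ℕ} (hn : 1 ≤ n) (x : ℝ) :
    f^[n] (-x) = f^[n] x := by
  obtain ⟨m, rfl⟩ := Nat.exists_eq_add_of_le' hn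
  rw [Function.iterate_succ_apply, Function.iterate_succ_apply, hf.even]

theorem iterate_abs (hf : EvenUnimodal f) {n : ℕ} (hn : 1 ≤ n) (x : ℝ) :
    f^[n] |x| = f^[n] x := by
  rcases abs_choice x with h | h <;> rw [h]
  exact hf.iterate_even hn x

theorem iterate_tendsto (hf : EvenUnimodal f) (n : ℕ) : Tendsto f^[n] atTop atTop := by
  induction n with
  | zero => exact tendsto_id
  | succ n ih => rw [Function.iterate_succ']; exact hf.tendsto.comp ih

/-- An interval free of turning points is mapped to one side of the critical point. -/
theorem sign (hf : EvenUnimodal f) {n : ℕ} {a b : ℝ} (hab : a < b)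
    (h : ∀ x ∈ Ioo a b, f^[n] x ≠ 0) :
    (∀ x ∈ Icc a b, 0 ≤ f^[n] x) ∨ (∀ x ∈ Icc a b, f^[n] x ≤ 0) := by
  have hcl : closure (Ioo a b) = Icc a b := closure_Ioo hab.ne
  have hc := hf.iterate_cont n
  have key : (∀ x ∈ Ioo a b, 0 ≤ f^[n] x) ∨ (∀ x ∈ Ioo a b, f^[n] x ≤ 0) := by
    by_contra hcon
    push Not at hcon
    obtain ⟨⟨x, hx, hx'⟩, y, hy, hy'⟩ := hcon
    obtain ⟨t, ht, ht'⟩ := isPreconnected_Ioo.intermediate_value hx hy hc.continuousOn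
      (show (0 : ℝ) ∈ Icc (f^[n] x) (f^[n] y) from ⟨hx'.le, hy'.le⟩)
    exact h t ht ht'
  rcases key with k | k
  · left
    rw [← hcl]
    exact closure_minimal (fun x hx => k x hx) (isClosed_le continuous_const hc)
  · right
    rw [← hcl]
    exact closure_minimal (fun x hx => k x hx) (isClosed_le hc continuous_const)

theorem strictMonoOn_or (hf : EvenUnimodal f) {n : ℕ} {a b : ℝ} (h : CritFree f n a b) :
    StrictMonoOn f^[n] (Icc a b) ∨ StrictAntiOn f^[n] (Icc a b) := by
  rcases le_or_gt b a with hab | hab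
  · left
    intro x hx y hy hxy
    linarith [hx.1, hy.2]
  induction n with
  | zero => left; exact strictMono_id.strictMonoOn _
  | succ n ih =>
    have ih := ih (h.mono n.le_succ le_rfl le_rfl)
    rw [Function.iterate_succ']
    rcases hf.sign hab (h n n.lt_succ_self) with s | s
    · rcases ih with ih | ih
      · exact Or.inl (hf.mono.comp ih s)
      · exact Or.inr (hf.mono.comp_strictAntiOn ih s)
    · rcases ih with ih | ih
      · exact Or.inr (hf.anti.comp_strictMonoOn ih s)
      · exact Or.inl (hf.anti.comp ih s)

theorem injOn (hf : EvenUnimodal f) {n : ℕ} {a b : ℝ} (h : CritFree f n a b) :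
    InjOn f^[n] (Icc a b) := by
  rcases hf.strictMonoOn_or h with h | h
  · exact h.injOn
  · exact h.injOn

theorem crossRatio_le (hf : EvenUnimodal f) {a b c d : ℝ} (hab : a < b) (hbc : b < c)
    (hcd : c < d) (ha : 0 ≤ a) :
    crossRatio a b c d ≤ crossRatio (f a) (f b) (f c) (f d) := by
  have hb : 0 ≤ b := by linarith
  have hc : 0 ≤ c := by linarith
  have hd : 0 ≤ d := by linarith
  have h1 := hf.mono ha hb hab
  have h2 := hf.mono hb hc hbc
  have h3 := hf.mono hc hd hcd
  unfold crossRatio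
  rw [abs_of_pos (sub_pos.2 hab), abs_of_pos (sub_pos.2 hbc), abs_of_pos (sub_pos.2 hcd),
    abs_of_pos (sub_pos.2 h1), abs_of_pos (sub_pos.2 h2), abs_of_pos (sub_pos.2 h3),
    abs_of_pos (by linarith : 0 < d - a), abs_of_pos (by linarith : 0 < f d - f a),
    div_le_div_iff₀ (mul_pos (sub_pos.2 hab) (sub_pos.2 hcd))
      (mul_pos (sub_pos.2 h1) (sub_pos.2 h3))]
  exact hf.cross a b c d ha hab hbc hcd

/-- Iterates without turning points expand cross-ratios. -/
theorem crossRatio_iterate (hf : EvenUnimodal f) {n : ℕ} {a b c d : ℝ} (h : CritFree f n a d)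
    (hab : a < b) (hbc : b < c) (hcd : c < d) :
    crossRatio a b c d ≤ crossRatio (f^[n] a) (f^[n] b) (f^[n] c) (f^[n] d) := by
  induction n with
  | zero => exact le_rfl
  | succ n ih =>
    have hn := h.mono n.le_succ le_rfl le_rfl
    refine (ih hn).trans ?_
    simp only [Function.iterate_succ_apply']
    have hac : a ≤ c := by linarith
    have had : a < d := by linarith
    have ma : a ∈ Icc a d := ⟨le_rfl, had.le⟩
    have mb : b ∈ Icc a d := ⟨hab.le, by linarith⟩
    have mc : c ∈ Icc a d := ⟨hac, hcd.le⟩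
    have md : d ∈ Icc a d := ⟨had.le, le_rfl⟩
    rcases hf.sign had (h n n.lt_succ_self) with s | s <;>
      rcases hf.strictMonoOn_or hn with m | m
    · exact hf.crossRatio_le (m ma mb hab) (m mb mc hbc) (m mc md hcd) (s a ma)
    · rw [← crossRatio_reverse, ← crossRatio_reverse (f _)]
      exact hf.crossRatio_le (m mc md hcd) (m mb mc hbc) (m ma mb hab) (s d md)
    · rw [← crossRatio_reverse, ← crossRatio_reverse (f _), ← crossRatio_neg]
      rw [← hf.even (f^[n] a), ← hf.even (f^[n] b), ← hf.even (f^[n] c), ← hf.even (f^[n] d)]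
      exact hf.crossRatio_le (neg_lt_neg (m mc md hcd)) (neg_lt_neg (m mb mc hbc))
        (neg_lt_neg (m ma mb hab)) (neg_nonneg.2 (s d md))
    · rw [← crossRatio_neg]
      rw [← hf.even (f^[n] a), ← hf.even (f^[n] b), ← hf.even (f^[n] c), ← hf.even (f^[n] d)]
      exact hf.crossRatio_le (neg_lt_neg (m ma mb hab)) (neg_lt_neg (m mb mc hbc))
        (neg_lt_neg (m mc md hcd)) (neg_nonneg.2 (s a ma))

/-- Interval lengths add up under a monotone iterate. -/
theorem abs_add (hf : EvenUnimodal f) {n : ℕ} {a d x y z : ℝ} (h : CritFree f n a d)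
    (hx : a ≤ x) (hxy : x ≤ y) (hyz : y ≤ z) (hz : z ≤ d) :
    |f^[n] z - f^[n] x| = |f^[n] y - f^[n] x| + |f^[n] z - f^[n] y| := by
  have mx : x ∈ Icc a d := ⟨hx, by linarith⟩
  have my : y ∈ Icc a d := ⟨by linarith, by linarith⟩
  have mz : z ∈ Icc a d := ⟨by linarith, hz⟩
  rcases hf.strictMonoOn_or h with m | m
  · have h1 := m.monotoneOn mx my hxy
    have h2 := m.monotoneOn my mz hyz
    rw [abs_of_nonneg (by linarith), abs_of_nonneg (by linarith), abs_of_nonneg (by linarith)]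
    ring
  · have h1 := m.antitoneOn mx my hxy
    have h2 := m.antitoneOn my mz hyz
    rw [abs_of_nonpos (by linarith), abs_of_nonpos (by linarith), abs_of_nonpos (by linarith)]
    ring

/-- Shrinking an interval shrinks its image under a monotone iterate. -/
theorem abs_le_abs (hf : EvenUnimodal f) {n : ℕ} {a d x x' y y' : ℝ} (h : CritFree f n a d)
    (hx : a ≤ x) (hxx : x ≤ x') (hxy : x' ≤ y') (hyy : y' ≤ y) (hy : y ≤ d) :
    |f^[n] y' - f^[n] x'| ≤ |f^[n] y - f^[n] x| := by
  rw [hf.abs_add h hx (hxx.trans hxy) hyy hy, hf.abs_add h hx hxx hxy (hyy.trans hy)]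
  linarith [abs_nonneg (f^[n] x' - f^[n] x), abs_nonneg (f^[n] y - f^[n] y')]

theorem _root_.CritFree.image (hf : EvenUnimodal f) {n j : ℕ} {a b : ℝ} (hab : a ≤ b)
    (h : CritFree f (n + j) a b) : CritFree f j (f^[n] a) (f^[n] b) := by
  intro i hi x hx
  obtain ⟨y, hy, rfl⟩ := intermediate_value_Ioo hab (hf.iterate_cont n).continuousOn hx
  rw [← Function.iterate_add_apply]
  exact h _ (by omega) y hy

theorem _root_.CritFree.image_reverse (hf : EvenUnimodal f) {n j : ℕ} {a b : ℝ} (hab : a ≤ b)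
    (h : CritFree f (n + j) a b) : CritFree f j (f^[n] b) (f^[n] a) := by
  intro i hi x hx
  obtain ⟨y, hy, rfl⟩ := intermediate_value_Ioo' hab (hf.iterate_cont n).continuousOn hx
  rw [← Function.iterate_add_apply]
  exact h _ (by omega) y hy

theorem _root_.CritFree.succ {n : ℕ} {a b : ℝ} (h : CritFree f n a b)
    (h' : ∀ x ∈ Ioo a b, f^[n] x ≠ 0) : CritFree f (n + 1) a b := by
  intro i hi x hx
  rcases Nat.lt_succ_iff_lt_or_eq.1 hi with hi | rfl
  · exact h i hi x hx
  · exact h' x hx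

theorem _root_.CritFree.succ_of_left (hf : EvenUnimodal f) {n : ℕ} {a b : ℝ}
    (h : CritFree f n a b) (ha : f^[n] a = 0) : CritFree f (n + 1) a b := by
  refine h.succ fun x hx hx0 => hx.1.ne ?_
  have hab := hx.1.trans hx.2
  exact hf.injOn h ⟨le_rfl, hab.le⟩ ⟨hx.1.le, hx.2.le⟩ (ha.trans hx0.symm)

theorem _root_.CritFree.succ_of_right (hf : EvenUnimodal f) {n : ℕ} {a b : ℝ}
    (h : CritFree f n a b) (hb : f^[n] b = 0) : CritFree f (n + 1) a b := by
  refine h.succ fun x hx hx0 => hx.2.ne ?_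
  have hab := hx.1.trans hx.2
  exact hf.injOn h ⟨hx.1.le, hx.2.le⟩ ⟨hab.le, le_rfl⟩ (hx0.trans hb.symm)

/-- A branch of `f^(n+1)` to the right of a preimage of the critical point is increasing, since the
preimage is a minimum. -/
theorem strictMonoOn_of_left (hf : EvenUnimodal f) {n : ℕ} {a b : ℝ}
    (h : CritFree f n a b) (ha : f^[n] a = 0) : StrictMonoOn f^[n + 1] (Icc a b) := by
  rcases hf.strictMonoOn_or (h.succ_of_left hf ha) with m | m
  · exact m
  · intro x hx y hy hxy
    have hl : a ∈ Icc a b := ⟨le_rfl, hx.1.trans hx.2⟩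
    have h1 := m hl hy (hx.1.trans_lt hxy)
    rw [Function.iterate_succ_apply', Function.iterate_succ_apply' f n a, ha] at h1
    exact absurd h1 (not_lt.2 (hf.min_le _))

theorem strictAntiOn_of_right (hf : EvenUnimodal f) {n : ℕ} {a b : ℝ}
    (h : CritFree f n a b) (hb : f^[n] b = 0) : StrictAntiOn f^[n + 1] (Icc a b) := by
  rcases hf.strictMonoOn_or (h.succ_of_right hf hb) with m | m
  · intro x hx y hy hxy
    have hl : b ∈ Icc a b := ⟨hx.1.trans hx.2, le_rfl⟩
    have h1 := m hx hl (hxy.trans_le hy.2)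
    rw [Function.iterate_succ_apply', Function.iterate_succ_apply' f n b, hb] at h1
    exact absurd h1 (not_lt.2 (hf.min_le _))
  · exact m

end EvenUnimodal

/-! ### The order of the intervals of a cycle -/

/-- The dynamics of a periodic interval `[-v, v]` of period `s` whose return map vanishes somewhere:
the first `s - 1` images avoid `(-v, v)`, the `s`-th one lies in `[-v, v]`, the boundary
points are nice, and `h` is the non-negative point of the interval with `f^s h = 0`. -/
structure PeriodicCycle (f : ℝ → ℝ) (v h : ℝ) (s : ℕ) : Prop where
  unimodal : EvenUnimodal f
  one_le : 1 ≤ s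
  pos : 0 < v
  nice : ∀ n, 1 ≤ n → f^[n] v ∉ Ioo (-v) v
  inv : ∀ x, |x| ≤ v → |f^[s] x| ≤ v
  disj : ∀ n, 1 ≤ n → n < s → ∀ x, |x| ≤ v → v ≤ |f^[n] x|
  mem : h ∈ Icc 0 v
  zero : f^[s] h = 0

namespace PeriodicCycle
variable {f : ℝ → ℝ} {v h : ℝ} {s : ℕ}

theorem abs_le_of_mem {x : ℝ} (hx : x ∈ Icc 0 v) : |x| ≤ v := by
  rw [abs_of_nonneg hx.1]; exact hx.2

theorem le_abs_iterate (H : PeriodicCycle f v h s) {n : ℕ} (hn : 1 ≤ n) : v ≤ |f^[n] v| := by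
  by_contra hcon
  exact H.nice n hn (abs_lt.1 (not_le.1 hcon))

theorem iterate_v_ne (H : PeriodicCycle f v h s) (n : ℕ) : f^[n] v ≠ 0 := by
  intro h0
  rcases Nat.eq_zero_or_pos n with rfl | hn
  · exact H.pos.ne' h0
  · have := H.le_abs_iterate hn
    rw [h0, abs_zero] at this
    linarith [H.pos]

theorem iterate_ne (H : PeriodicCycle f v h s) {n : ℕ} (hn : 1 ≤ n) (hns : n < s) {x : ℝ}
    (hx : |x| ≤ v) : f^[n] x ≠ 0 := by
  intro h0
  have := H.disj n hn hns x hx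
  rw [h0, abs_zero] at this
  linarith [H.pos]

theorem abs_iterate_s (H : PeriodicCycle f v h s) : |f^[s] v| = v :=
  le_antisymm (H.inv v (abs_of_pos H.pos).le) (H.le_abs_iterate H.one_le)

theorem critFree (H : PeriodicCycle f v h s) : CritFree f s 0 v := by
  intro i hi x hx
  rcases Nat.eq_zero_or_pos i with rfl | hi0
  · exact hx.1.ne'
  · exact H.iterate_ne hi0 hi (abs_le_of_mem ⟨hx.1.le, hx.2.le⟩)

theorem injOn (H : PeriodicCycle f v h s) {n : ℕ} (hn : n ≤ s) : InjOn f^[n] (Icc 0 v) :=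
  H.unimodal.injOn (H.critFree.mono hn le_rfl le_rfl)

/-- Interior points of the half interval never land on the boundary within one period. -/
theorem abs_iterate_ne (H : PeriodicCycle f v h s) {n : ℕ} (hn : 1 ≤ n) (hns : n ≤ s) {x : ℝ}
    (hx : x ∈ Ioo 0 v) : |f^[n] x| ≠ v := by
  intro hv
  have hv' := H.pos
  -- the image under `f^n` of `[0, v]` is a monotone interval on one side of `[-v, v]` or inside it
  have side : (∀ y ∈ Icc 0 v, |f^[n] y| ≤ v) ∨ (∀ y ∈ Icc 0 v, v ≤ f^[n] y) ∨
      (∀ y ∈ Icc 0 v, f^[n] y ≤ -v) := by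
    rcases hns.lt_or_eq with hlt | rfl
    · right
      rcases H.unimodal.sign hv' (fun y hy => H.critFree n hlt y hy) with k | k
      · left
        intro y hy
        rw [← abs_of_nonneg (k y hy)]
        exact H.disj n hn hlt y (abs_le_of_mem hy)
      · right
        intro y hy
        have := H.disj n hn hlt y (abs_le_of_mem hy)
        rw [abs_of_nonpos (k y hy)] at this
        linarith
    · left
      intro y hy
      exact H.inv y (abs_le_of_mem hy)
  have h0 : (0 : ℝ) ∈ Icc 0 v := ⟨le_rfl, hv'.le⟩
  have h1 : v ∈ Icc 0 v := ⟨hv'.le, le_rfl⟩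
  have hx' : x ∈ Icc 0 v := ⟨hx.1.le, hx.2.le⟩
  have btw : (f^[n] 0 < f^[n] x ∧ f^[n] x < f^[n] v) ∨ (f^[n] v < f^[n] x ∧ f^[n] x < f^[n] 0) := by
    rcases H.unimodal.strictMonoOn_or (H.critFree.mono hns le_rfl le_rfl) with m | m
    · exact Or.inl ⟨m h0 hx' hx.1, m hx' h1 hx.2⟩
    · exact Or.inr ⟨m hx' h1 hx.2, m h0 hx' hx.1⟩
  rcases side with k | k | k
  · have k0 := abs_le.1 (k 0 h0)
    have k1 := abs_le.1 (k v h1)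
    rcases abs_choice (f^[n] x) with e | e <;> rw [e] at hv <;> rcases btw with b | b <;> linarith
  · have := k 0 h0; have := k v h1; have := k x hx'
    rw [abs_of_nonneg (by linarith)] at hv
    rcases btw with b | b <;> linarith
  · have := k 0 h0; have := k v h1; have := k x hx'
    rw [abs_of_nonpos (by linarith)] at hv
    rcases btw with b | b <;> linarith

/-- The images `f^i [0, v]`, `1 ≤ i ≤ s`, have disjoint interiors. -/
theorem iterate_ne_iterate (H : PeriodicCycle f v h s) {i j : ℕ} (hi : 1 ≤ i) (his : i ≤ s)
    (hj : 1 ≤ j) (hjs : j ≤ s) (hij : i ≠ j) {x y : ℝ} (hx : x ∈ Icc 0 v) (hy : y ∈ Ioo 0 v) :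
    f^[i] x ≠ f^[j] y := by
  intro h0
  have hy' := abs_le_of_mem ⟨hy.1.le, hy.2.le⟩
  rcases hij.lt_or_gt with hlt | hlt
  · have h1 : f^[s - j + i] x = f^[s] y := by
      rw [Function.iterate_add_apply, h0, ← Function.iterate_add_apply, Nat.sub_add_cancel hjs]
    have h2 := H.disj (s - j + i) (by omega) (by omega) x (abs_le_of_mem hx)
    have h3 := H.inv y hy'
    rw [h1] at h2
    exact H.abs_iterate_ne H.one_le le_rfl hy (le_antisymm h3 h2)
  · have h1 : f^[s - i + j] y = f^[s] x := by
      rw [Function.iterate_add_apply, ← h0, ← Function.iterate_add_apply, Nat.sub_add_cancel his]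
    have h2 := H.disj (s - i + j) (by omega) (by omega) y hy'
    have h3 := H.inv x (abs_le_of_mem hx)
    exact H.abs_iterate_ne (n := s - i + j) (by omega) (by omega) hy
      (le_antisymm (h1 ▸ h3) h2)

/-- Any two images `f^i [0, v]` and `f^j [0, v]` lie side by side. -/
theorem le_or_le (H : PeriodicCycle f v h s) {i j : ℕ} (hi : 1 ≤ i) (his : i ≤ s)
    (hj : 1 ≤ j) (hjs : j ≤ s) (hij : i ≠ j) :
    (∀ x ∈ Icc 0 v, ∀ y ∈ Icc 0 v, f^[i] x ≤ f^[j] y) ∨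
      (∀ x ∈ Icc 0 v, ∀ y ∈ Icc 0 v, f^[j] y ≤ f^[i] x) := by
  have ci := H.unimodal.iterate_cont i
  have cj := H.unimodal.iterate_cont j
  have hcl : closure (Ioo 0 v) = Icc 0 v := closure_Ioo H.pos.ne
  have ext : ∀ a b : ℝ → ℝ, Continuous a → Continuous b →
      (∀ x ∈ Ioo 0 v, ∀ y ∈ Ioo 0 v, a x ≤ b y) → ∀ x ∈ Icc 0 v, ∀ y ∈ Icc 0 v, a x ≤ b y := by
    intro a b ha hb hab
    have h1 : ∀ x ∈ Icc 0 v, ∀ y ∈ Ioo 0 v, a x ≤ b y := by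
      intro x hx y hy
      rw [← hcl] at hx
      exact closure_minimal (t := {x | a x ≤ b y}) (fun x hx => hab x hx y hy)
        (isClosed_le ha continuous_const) hx
    intro x hx y hy
    rw [← hcl] at hy
    exact closure_minimal (t := {y | a x ≤ b y}) (fun y hy => h1 x hx y hy)
      (isClosed_le continuous_const hb) hy
  by_cases hA : ∀ x ∈ Ioo 0 v, ∀ y ∈ Ioo 0 v, f^[i] x ≤ f^[j] y
  · exact Or.inl (ext _ _ ci cj hA)
  by_cases hB : ∀ y ∈ Ioo 0 v, ∀ x ∈ Ioo 0 v, f^[j] y ≤ f^[i] x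
  · exact Or.inr fun x hx y hy => ext _ _ cj ci hB y hy x hx
  exfalso
  push Not at hA hB
  obtain ⟨x₀, hx₀, y₀, hy₀, h₀⟩ := hA
  obtain ⟨y₁, hy₁, x₁, hx₁, h₁⟩ := hB
  have hc : Continuous fun t : ℝ =>
      f^[i] ((1 - t) * x₀ + t * x₁) - f^[j] ((1 - t) * y₀ + t * y₁) :=
    (ci.comp (by fun_prop)).sub (cj.comp (by fun_prop))
  obtain ⟨t, ht, ht0⟩ := intermediate_value_Icc' zero_le_one hc.continuousOn
    (show (0 : ℝ) ∈ Icc _ _ by constructor <;> norm_num <;> linarith)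
  have conv : ∀ a b : ℝ, a ∈ Ioo 0 v → b ∈ Ioo 0 v → (1 - t) * a + t * b ∈ Ioo 0 v := by
    intro a b ha hb
    exact (convex_Ioo 0 v) ha hb (by linarith [ht.2]) ht.1 (by ring)
  have hX := conv x₀ x₁ hx₀ hx₁
  exact H.iterate_ne_iterate hi his hj hjs hij ⟨hX.1.le, hX.2.le⟩ (conv y₀ y₁ hy₀ hy₁)
    (sub_eq_zero.1 ht0)

theorem le_of_lt (H : PeriodicCycle f v h s) {i j : ℕ} (hi : 1 ≤ i) (his : i ≤ s)
    (hj : 1 ≤ j) (hjs : j ≤ s) {x₀ y₀ : ℝ} (hij : i ≠ j) (hx₀ : x₀ ∈ Icc 0 v) (hy₀ : y₀ ∈ Icc 0 v)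
    (hlt : f^[i] x₀ < f^[j] y₀) {x y : ℝ} (hx : x ∈ Icc 0 v) (hy : y ∈ Icc 0 v) :
    f^[i] x ≤ f^[j] y := by
  rcases H.le_or_le hi his hj hjs hij with k | k
  · exact k x hx y hy
  · exact absurd hlt (not_lt.2 (k x₀ hx₀ y₀ hy₀))

theorem iterate_h_ne (H : PeriodicCycle f v h s) {i j : ℕ} (hi : 1 ≤ i) (hij : i < j)
    (hjs : j ≤ s) : f^[i] h ≠ f^[j] h := by
  intro h0
  refine H.iterate_ne (n := s - j + i) (by omega) (by omega) (abs_le_of_mem H.mem) ?_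
  rw [Function.iterate_add_apply, h0, ← Function.iterate_add_apply, Nat.sub_add_cancel hjs, H.zero]

theorem iterate_h_lt_or (H : PeriodicCycle f v h s) {i j : ℕ} (hi : 1 ≤ i) (his : i ≤ s)
    (hj : 1 ≤ j) (hjs : j ≤ s) (hij : i ≠ j) : f^[i] h < f^[j] h ∨ f^[j] h < f^[i] h := by
  rcases hij.lt_or_gt with k | k
  · exact (H.iterate_h_ne hi k hjs).lt_or_gt
  · exact (H.iterate_h_ne hj k his).lt_or_gt.symm

theorem zero_mem (H : PeriodicCycle f v h s) : (0 : ℝ) ∈ Icc 0 v := ⟨le_rfl, H.pos.le⟩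

theorem v_mem (H : PeriodicCycle f v h s) : v ∈ Icc 0 v := ⟨H.pos.le, le_rfl⟩

theorem iterate_h_ne_iterate_v (H : PeriodicCycle f v h s) {i : ℕ} (his : i ≤ s) (n : ℕ) :
    f^[i] h ≠ f^[n] v := by
  intro h0
  apply H.iterate_v_ne (s - i + n)
  rw [Function.iterate_add_apply, ← h0, ← Function.iterate_add_apply, Nat.sub_add_cancel his,
    H.zero]

theorem h_lt_v (H : PeriodicCycle f v h s) : h < v :=
  H.mem.2.lt_of_ne (H.iterate_h_ne_iterate_v (i := 0) (Nat.zero_le _) 0)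

theorem f_zero_lt (H : PeriodicCycle f v h s) {x : ℝ} (hx : x ≠ 0) : f 0 < f x := by
  rw [H.unimodal.lt_iff, abs_zero]
  exact abs_pos.2 hx

theorem f_zero_le_neg (H : PeriodicCycle f v h s) (hs : 2 ≤ s) : f 0 ≤ -v := by
  have h1 := H.disj 1 le_rfl hs 0 (abs_le_of_mem H.zero_mem)
  have h2 : f 0 ≤ 0 := by
    have h2 := H.zero
    rw [show s = s - 1 + 1 by omega, Function.iterate_succ_apply'] at h2
    exact h2 ▸ H.unimodal.min_le _
  rw [Function.iterate_one, abs_of_nonpos h2] at h1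
  linarith

theorem f_v_le_neg (H : PeriodicCycle f v h s) (hs : 2 ≤ s) : f v ≤ -v := by
  have h1 := H.le_abs_iterate (n := 1) le_rfl
  rw [Function.iterate_one] at h1
  rcases H.unimodal.sign (n := 1) H.pos (fun y hy => H.critFree 1 hs y hy) with k | k
  · have := k 0 H.zero_mem
    rw [Function.iterate_one] at this
    linarith [H.f_zero_le_neg hs, H.pos]
  · have := k v H.v_mem
    rw [Function.iterate_one] at this
    rw [abs_of_nonpos this] at h1
    linarith

/-- The image `f [0, v]` is the leftmost interval of the cycle. -/
theorem f_v_le (H : PeriodicCycle f v h s) {i : ℕ} (hi : 2 ≤ i) (his : i ≤ s) {x : ℝ}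
    (hx : x ∈ Icc 0 v) : f v ≤ f^[i] x := by
  have hne : f^[i] 0 ≠ f^[i] v := fun e => H.pos.ne (H.injOn his H.zero_mem H.v_mem e)
  have hmin : ∀ y, f 0 ≤ f^[i] y := by
    intro y
    rw [show i = i - 1 + 1 by omega, Function.iterate_succ_apply']
    exact H.unimodal.min_le _
  obtain ⟨y, hy, hlt⟩ : ∃ y ∈ Icc 0 v, f^[1] 0 < f^[i] y := by
    rw [Function.iterate_one]
    rcases (hmin 0).lt_or_eq with k | k
    · exact ⟨0, H.zero_mem, k⟩
    · exact ⟨v, H.v_mem, (hmin v).lt_of_ne (k ▸ hne)⟩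
  have := H.le_of_lt (i := 1) (j := i) le_rfl (by omega) (by omega) his (by omega) H.zero_mem hy hlt
    H.v_mem hx
  rwa [Function.iterate_one] at this

theorem f_v_lt (H : PeriodicCycle f v h s) {i : ℕ} (hi : 2 ≤ i) (his : i ≤ s) :
    f v < f^[i] h :=
  (H.f_v_le hi his H.mem).lt_of_ne fun e => H.iterate_h_ne_iterate_v his 1
    (by rw [Function.iterate_one]; exact e.symm)

/-- The orbit of `h` reaches the critical point at time `s`; so a branch of `f^n` without turning
points that contains `f^i h` has `n + i ≤ s`. -/
theorem add_le_of_critFree (H : PeriodicCycle f v h s) {n i : ℕ} {a b : ℝ}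
    (hF : CritFree f n a b) (his : i ≤ s) (ha : a < f^[i] h) (hb : f^[i] h < b) : n + i ≤ s := by
  by_contra hcon
  refine hF (s - i) (by omega) _ ⟨ha, hb⟩ ?_
  rw [← Function.iterate_add_apply, Nat.sub_add_cancel his, H.zero]

/-- A preimage of `0` of order less than `s` in an interval of the cycle is on the orbit of `h`. -/
theorem eq_of_iterate_eq_zero (H : PeriodicCycle f v h s) {n i : ℕ} (hn : n < s) (hi : 1 ≤ i)
    (his : i ≤ s) {x : ℝ} (hx : x ∈ Icc 0 v) (h0 : f^[n] (f^[i] x) = 0) : n + i = s ∧ x = h := by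
  rw [← Function.iterate_add_apply] at h0
  rcases lt_trichotomy (n + i) s with k | k | k
  · exact absurd h0 (H.iterate_ne (by omega) k (abs_le_of_mem hx))
  · rw [k] at h0
    exact ⟨k, H.injOn le_rfl hx H.mem (h0.trans H.zero.symm)⟩
  · refine absurd ?_
      (H.iterate_ne (n := n + i - s) (by omega) (by omega) (H.inv x (abs_le_of_mem hx)))
    rw [← Function.iterate_add_apply, Nat.sub_add_cancel k.le, h0]

/-- A monotone iterate of an interval that contains several intervals of the cycle has at least
as many times the length of the shortest one. -/
theorem card_mul_le (H : PeriodicCycle f v h s) {μ : ℝ}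
    (hμ : ∀ i, 1 ≤ i → i ≤ s → μ ≤ |f^[i] v - f^[i] 0|) {n : ℕ} {a b : ℝ} (hF : CritFree f n a b)
    (S : Finset ℕ) (hS : ∀ i ∈ S, 1 ≤ i ∧ n + i ≤ s ∧ ∀ x ∈ Icc 0 v, a ≤ f^[i] x ∧ f^[i] x ≤ b) :
    S.card * μ ≤ |f^[n] b - f^[n] a| := by
  induction S using Finset.induction_on_max_value (fun i => f^[i] h) generalizing b with
  | empty => simp
  | @insert i S hi hmax ih =>
    obtain ⟨h1, h2, h3⟩ := hS i (Finset.mem_insert_self i S)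
    have e0 := h3 0 H.zero_mem
    have ev := h3 v H.v_mem
    set y := min (f^[i] 0) (f^[i] v) with hy
    set y' := max (f^[i] 0) (f^[i] v) with hy'
    have hay : a ≤ y := le_min e0.1 ev.1
    have hyb : y' ≤ b := max_le e0.2 ev.2
    have hyy : y ≤ y' := min_le_max
    have key := ih (b := y) (hF.mono le_rfl le_rfl (hyy.trans hyb)) (by
      intro j hj
      obtain ⟨j1, j2, j3⟩ := hS j (Finset.mem_insert_of_mem hj)
      refine ⟨j1, j2, fun x hx => ⟨(j3 x hx).1, ?_⟩⟩
      have hji : j ≠ i := fun e => hi (e ▸ hj)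
      have hlt : f^[j] h < f^[i] h := by
        rcases H.iterate_h_lt_or j1 (by omega) h1 (by omega) hji with k | k
        · exact k
        · exact absurd (hmax j hj) (not_le.2 k)
      exact le_min (H.le_of_lt j1 (by omega) h1 (by omega) hji H.mem H.mem hlt hx H.zero_mem)
        (H.le_of_lt j1 (by omega) h1 (by omega) hji H.mem H.mem hlt hx H.v_mem))
    rw [H.unimodal.abs_add hF le_rfl hay (hyy.trans hyb) le_rfl,
      Finset.card_insert_of_notMem hi]
    have k1 := H.unimodal.abs_le_abs hF hay le_rfl hyy hyb le_rfl
    have k2 : |f^[n] y' - f^[n] y| = |f^[n + i] v - f^[n + i] 0| := by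
      rw [Function.iterate_add_apply, Function.iterate_add_apply]
      rcases le_total (f^[i] 0) (f^[i] v) with k | k
      · rw [hy, hy', min_eq_left k, max_eq_right k]
      · rw [hy, hy', min_eq_right k, max_eq_left k, abs_sub_comm]
    have k3 := hμ (n + i) (by omega) h2
    push_cast
    linarith

end PeriodicCycle

/-! ### Numerical consequences of cross-ratio expansion -/

namespace EvenUnimodal
variable {f : ℝ → ℝ}

/-- Expansion of cross-ratios with the denominators cleared; the image lengths are written as those
of the middle interval and of its two neighbours. -/
theorem cross_mul_le (hf : EvenUnimodal f) {n : ℕ} {a b c d : ℝ} (h : CritFree f n a d)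
    (hab : a < b) (hbc : b < c) (hcd : c < d) :
    (c - b) * (d - a) * (|f^[n] b - f^[n] a| * |f^[n] d - f^[n] c|) ≤
      |f^[n] c - f^[n] b| *
        (|f^[n] b - f^[n] a| + |f^[n] c - f^[n] b| + |f^[n] d - f^[n] c|) *
        ((b - a) * (d - c)) := by
  have key := hf.crossRatio_iterate h hab hbc hcd
  have inj := hf.injOn h
  have ma : a ∈ Icc a d := ⟨le_rfl, by linarith⟩
  have mb : b ∈ Icc a d := ⟨hab.le, by linarith⟩
  have mc : c ∈ Icc a d := ⟨by linarith, hcd.le⟩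
  have md : d ∈ Icc a d := ⟨by linarith, le_rfl⟩
  have p1 : 0 < |f^[n] b - f^[n] a| :=
    abs_pos.2 (sub_ne_zero.2 fun e => hab.ne' (inj mb ma e))
  have p2 : 0 < |f^[n] d - f^[n] c| :=
    abs_pos.2 (sub_ne_zero.2 fun e => hcd.ne' (inj md mc e))
  have e1 : |f^[n] d - f^[n] a| =
      |f^[n] b - f^[n] a| + |f^[n] c - f^[n] b| + |f^[n] d - f^[n] c| := by
    rw [hf.abs_add h le_rfl (by linarith : a ≤ c) hcd.le le_rfl,
      hf.abs_add h le_rfl hab.le hbc.le hcd.le]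
  unfold crossRatio at key
  rw [e1, abs_of_pos (sub_pos.2 hab), abs_of_pos (sub_pos.2 hbc), abs_of_pos (sub_pos.2 hcd),
    abs_of_pos (by linarith : 0 < d - a),
    div_le_div_iff₀ (mul_pos (sub_pos.2 hab) (sub_pos.2 hcd)) (mul_pos p1 p2)] at key
  exact key

end EvenUnimodal

/-- The numerical contradiction behind the constant `0.6`, in normalized form. -/
theorem cross_contradiction_aux {d β a g : ℝ} (hd : 0 < d) (hβ : 0 < β) (hg : 0 < g)
    (hdβ : d + β < 0.6) (ha : 1 + g ≤ a) (h1 : a < d * (2 + a))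
    (h2 : d * (1 + d + β) ≤ g * (2 + g) * β) : False := by
  have hd6 : d < 0.6 := by linarith
  have hA : (1 + g) * (1 - d) < 2 * d := by
    have : (1 + g) * (1 - d) ≤ a * (1 - d) :=
      mul_le_mul_of_nonneg_right ha (by linarith)
    linarith
  -- the second inequality is affine in `β`, hence may be tested at `β = 0.6 - d`
  have hB : 1.6 * d < g * (2 + g) * (0.6 - d) := by
    have : 0 < g * (2 + g) - d := by
      by_contra hcon
      nlinarith
    nlinarith
  have hC : (g * (2 + g)) * (1 - d) ^ 2 < (3 * d - 1) * (d + 1) := by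
    have h3 : 0 < (1 + g) * (1 - d) := mul_pos (by linarith) (by linarith)
    nlinarith
  have hE : 1.6 * d * (1 - d) ^ 2 < (3 * d - 1) * (d + 1) * (0.6 - d) := by
    have h3 : 0 < (1 - d) ^ 2 := pow_pos (by linarith) 2
    have h4 : 0 < 0.6 - d := by linarith
    have := mul_lt_mul_of_pos_right hB h3
    have := mul_lt_mul_of_pos_right hC h4
    linarith
  have hd3 : 1 / 3 < d := by
    by_contra hcon
    push Not at hcon
    have : 0 < d * (1 - d) ^ 2 := mul_pos hd (pow_pos (by linarith) 2)
    have : 0 ≤ (1 - 3 * d) * (d + 1) * (0.6 - d) :=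
      mul_nonneg (mul_nonneg (by linarith) (by linarith)) (by linarith)
    linarith
  -- on `1 / 3 < d < 0.6` the right side of `hE` is below `0.09` and the left side above
  have k1 : (3 * d - 1) * (0.6 - d) < 0.054 := by nlinarith [sq_nonneg (d - 7 / 15)]
  have k2 : (3 * d - 1) * (d + 1) * (0.6 - d) < 0.09 := by
    have : 0 < (3 * d - 1) * (0.6 - d) := mul_pos (by linarith) (by linarith)
    nlinarith
  have k3 : 0.16 * d < d * (1 - d) ^ 2 := by nlinarith
  have k4 : 1.6 * (0.16 * d) ≤ 1.6 * d * (1 - d) ^ 2 := by linarith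
  nlinarith

/-- Expansion of two nested cross-ratios excludes that the interval of length `β` lies within
`0.6` of the leftmost interval (of length `m₁`), when all intervals have length at least `μ`. -/
theorem cross_contradiction {m₁ μ R A u w g d β : ℝ} (hm : 0 < m₁) (hμ : 0 < μ) (hR : μ ≤ R)
    (hA : u + g ≤ A) (hu : μ ≤ u) (hw : μ ≤ w) (hg : 0 < g) (hd : 0 < d) (hβ : 0 < β)
    (hdβ : d + β < 0.6 * m₁) (h1 : m₁ * (R * A) < d * (μ * (R + μ + A)))
    (h2 : d * (m₁ + d + β) * (u * w) ≤ g * (u + g + w) * (m₁ * β)) : False := by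
  obtain ⟨d, rfl⟩ : ∃ d', d = m₁ * d' := ⟨d / m₁, by field_simp⟩
  obtain ⟨β, rfl⟩ : ∃ d', β = m₁ * d' := ⟨β / m₁, by field_simp⟩
  obtain ⟨R, rfl⟩ : ∃ d', R = μ * d' := ⟨R / μ, by field_simp⟩
  obtain ⟨A, rfl⟩ : ∃ d', A = μ * d' := ⟨A / μ, by field_simp⟩
  obtain ⟨u, rfl⟩ : ∃ d', u = μ * d' := ⟨u / μ, by field_simp⟩
  obtain ⟨w, rfl⟩ : ∃ d', w = μ * d' := ⟨w / μ, by field_simp⟩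
  obtain ⟨g, rfl⟩ : ∃ d', g = μ * d' := ⟨g / μ, by field_simp⟩
  have hd := pos_of_mul_pos_right hd hm.le
  have hβ := pos_of_mul_pos_right hβ hm.le
  have hg := pos_of_mul_pos_right hg hμ.le
  have hR : 1 ≤ R := by nlinarith
  have hu : 1 ≤ u := by nlinarith
  have hw : 1 ≤ w := by nlinarith
  have hA : u + g ≤ A := by
    have : μ * (u + g) ≤ μ * A := by linarith
    exact le_of_mul_le_mul_left this hμ
  have hdβ : d + β < 0.6 := by
    have : m₁ * (d + β) < m₁ * 0.6 := by linarith
    exact lt_of_mul_lt_mul_left this hm.le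
  have h1 : R * A < d * (R + 1 + A) := by
    have : (m₁ * μ ^ 2) * (R * A) < (m₁ * μ ^ 2) * (d * (R + 1 + A)) := by linarith
    exact lt_of_mul_lt_mul_left this (by positivity)
  have h2 : d * (1 + d + β) * (u * w) ≤ g * (u + g + w) * β := by
    have : (m₁ ^ 2 * μ ^ 2) * (d * (1 + d + β) * (u * w)) ≤
        (m₁ ^ 2 * μ ^ 2) * (g * (u + g + w) * β) := by linarith
    exact le_of_mul_le_mul_left this (by positivity)
  refine cross_contradiction_aux hd hβ hg hdβ (a := A) (by linarith) ?_ ?_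
  · have : 0 ≤ (R - 1) * (A - d) := mul_nonneg (by linarith) (by linarith)
    nlinarith
  · have huw : 1 ≤ u * w := by nlinarith
    have h3 : g * (u + g + w) ≤ g * (2 + g) * (u * w) := by
      have e1 : u ≤ u * w := by nlinarith
      have e2 : w ≤ u * w := by nlinarith
      have e3 : g ≤ g * (u * w) := by nlinarith
      have : u + g + w ≤ (2 + g) * (u * w) := by linarith
      calc g * (u + g + w) ≤ g * ((2 + g) * (u * w)) := mul_le_mul_of_nonneg_left this hg.le
        _ = _ := by ring
    have h4 : d * (1 + d + β) * (u * w) ≤ g * (2 + g) * β * (u * w) :=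
      h2.trans (by nlinarith [mul_le_mul_of_nonneg_right h3 hβ.le])
    exact le_of_mul_le_mul_right h4 (by linarith)

/-- With `μ` the length of the shortest interval and `R`, `A` the image lengths of the left and
right neighbours of `f [0, v]`, the basic estimate forbids these three size patterns. The constant
`0.6 = 3 / 5` is the threshold for `(3, 1)` and `(1, 3)`. -/
theorem ratio_contradiction {m₁ μ R A d : ℝ} (hm : 0 < m₁) (hμ : 0 < μ) (hd : d ≤ 0.6 * m₁)
    (h1 : m₁ * (R * A) < d * (μ * (R + μ + A)))
    (h : (3 * μ ≤ R ∧ μ ≤ A) ∨ (2 * μ ≤ R ∧ 2 * μ ≤ A) ∨ (μ ≤ R ∧ 3 * μ ≤ A)) : False := by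
  have hR : 0 ≤ R := by rcases h with h | h | h <;> linarith
  have hA : 0 ≤ A := by rcases h with h | h | h <;> linarith
  have h2 : m₁ * (R * A) < m₁ * (0.6 * (μ * (R + μ + A))) := by
    have : d * (μ * (R + μ + A)) ≤ 0.6 * m₁ * (μ * (R + μ + A)) :=
      mul_le_mul_of_nonneg_right hd (by positivity)
    linarith
  have h3 := lt_of_mul_lt_mul_left h2 hm.le
  rcases h with ⟨a, b⟩ | ⟨a, b⟩ | ⟨a, b⟩
  · nlinarith [mul_nonneg (sub_nonneg.2 a) (sub_nonneg.2 b)]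
  · nlinarith [mul_nonneg (sub_nonneg.2 a) (sub_nonneg.2 b)]
  · nlinarith [mul_nonneg (sub_nonneg.2 a) (sub_nonneg.2 b)]

/-! ### The branch around the leftmost interval of the cycle -/

theorem CritFree.trans {f : ℝ → ℝ} {n : ℕ} {a b c : ℝ} (h₁ : CritFree f n a b)
    (h₂ : CritFree f n b c) (hb : ∀ i < n, f^[i] b ≠ 0) : CritFree f n a c := by
  intro i hi x hx
  rcases lt_trichotomy x b with k | rfl | k
  · exact h₁ i hi x ⟨hx.1, k⟩
  · exact hb i hi
  · exact h₂ i hi x ⟨k, hx.2⟩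

theorem EvenUnimodal.isClosed_exists_zero {f : ℝ → ℝ} (hf : EvenUnimodal f) (n : ℕ) :
    IsClosed {x | ∃ i < n, f^[i] x = 0} := by
  have : {x | ∃ i < n, f^[i] x = 0} = ⋃ i ∈ Finset.range n, f^[i] ⁻¹' {0} := by
    ext x; simp
  rw [this]
  exact isClosed_biUnion_finset fun i _ => isClosed_singleton.preimage (hf.iterate_cont i)

namespace PeriodicCycle
variable {f : ℝ → ℝ} {v h : ℝ} {s : ℕ}

theorem f_zero_lt_f_v (H : PeriodicCycle f v h s) : f 0 < f v := H.f_zero_lt H.pos.ne'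

theorem f_zero_le_iterate (H : PeriodicCycle f v h s) {i : ℕ} (hi : 1 ≤ i) (x : ℝ) :
    f 0 ≤ f^[i] x := by
  rw [show i = i - 1 + 1 by omega, Function.iterate_succ_apply']
  exact H.unimodal.min_le _

theorem critFree_f (H : PeriodicCycle f v h s) {n : ℕ} (hn : n < s) :
    CritFree f n (f 0) (f v) := by
  have := CritFree.image H.unimodal (n := 1) (j := n) H.pos.le
    (H.critFree.mono (by omega) le_rfl le_rfl)
  rwa [Function.iterate_one] at this

theorem iterate_f_zero_ne (H : PeriodicCycle f v h s) {n : ℕ} (hn : n + 1 < s) :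
    f^[n] (f 0) ≠ 0 :=
  H.iterate_ne (n := n + 1) (by omega) hn (abs_le_of_mem H.zero_mem)

theorem iterate_f_v_ne (H : PeriodicCycle f v h s) (n : ℕ) : f^[n] (f v) ≠ 0 :=
  H.iterate_v_ne (n + 1)

/-- The branch of `f^(n+1)` between the critical value and a preimage `x` of the critical point is
decreasing, so it maps intervals of the cycle to the left of `f^(n+2) v`. -/
theorem shift (H : PeriodicCycle f v h s) {n i : ℕ} {x : ℝ}
    (hF : CritFree f n (f 0) x) (hx : f^[n] x = 0) (hi : 2 ≤ i) (his : i ≤ s)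
    (hz : f^[i] h < x) (hV : ∀ y ∈ Icc 0 v, f^[i] y ≤ x) :
    n + 1 + i ≤ s ∧ ∀ y ∈ Icc 0 v, f^[n + 1 + i] y ≤ f^[n + 2] v := by
  have hlt := H.f_v_lt hi his
  have h0 := H.f_zero_lt_f_v
  refine ⟨H.add_le_of_critFree (hF.succ_of_right H.unimodal hx) his (h0.trans hlt) hz, ?_⟩
  intro y hy
  have m := (H.unimodal.strictAntiOn_of_right hF hx).antitoneOn
  have := H.f_v_le hi his hy
  rw [Function.iterate_add_apply]
  exact m ⟨h0.le, hlt.le.trans hz.le⟩ ⟨h0.le.trans this, hV y hy⟩ this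

/-- To the right of `f [0, v]`, the branch of `f^n` ends at a preimage of `0`. -/
theorem exists_right_end (H : PeriodicCycle f v h s) (hs : 2 ≤ s) {n : ℕ} (hn : 1 ≤ n)
    (hns : n < s) : ∃ r, f v < r ∧ CritFree f n (f 0) r ∧ ∃ e < n, f^[e] r = 0 := by
  set Z := {x | ∃ i < n, f^[i] x = 0} ∩ Ici (f v) with hZ
  have hcl : IsClosed Z := (H.unimodal.isClosed_exists_zero n).inter isClosed_Ici
  have hne : Z.Nonempty := by
    have := H.f_v_le_neg hs
    exact ⟨0, ⟨0, hn, rfl⟩, mem_Ici.2 (by linarith [H.pos])⟩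
  have hbd : BddBelow Z := ⟨f v, fun x hx => hx.2⟩
  obtain ⟨⟨e, he, he0⟩, hr⟩ := hcl.csInf_mem hne hbd
  refine ⟨sInf Z, lt_of_le_of_ne hr ?_, ?_, e, he, he0⟩
  · intro e'
    exact H.iterate_f_v_ne e (e' ▸ he0)
  · refine (H.critFree_f hns).trans ?_ fun i _ => H.iterate_f_v_ne i
    intro i hi x hx h0
    exact absurd (csInf_le hbd ⟨⟨i, hi, h0⟩, hx.1.le⟩) (not_le.2 hx.2)

/-- To the left of the critical value, the branch of `f^n` ends at a preimage of `0`, or its image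
is as long as one likes. -/
theorem exists_left_end (H : PeriodicCycle f v h s) {n : ℕ} (hn : 1 ≤ n)
    (hns : n < s) (M : ℝ) : ∃ r, r < f 0 ∧ CritFree f n r (f 0) ∧
      ((∃ e < n, f^[e] r = 0) ∨ M ≤ |f^[n] (f 0) - f^[n] r|) := by
  set Z := {x | ∃ i < n, f^[i] x = 0} ∩ Iic (f 0) with hZ
  have hcl : IsClosed Z := (H.unimodal.isClosed_exists_zero n).inter isClosed_Iic
  rcases Z.eq_empty_or_nonempty with hem | hne
  · have hfree : ∀ a, CritFree f n a (f 0) := fun a i hi x hx h0 =>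
      (eq_empty_iff_forall_notMem.1 hem x) ⟨⟨i, hi, h0⟩, hx.2.le⟩
    have ht := (H.unimodal.iterate_tendsto n).eventually_ge_atTop (M + f^[n] (f 0))
    obtain ⟨x, hx, hx'⟩ := (ht.and (eventually_gt_atTop |f 0|)).exists
    refine ⟨-x, by linarith [neg_abs_le (f 0)], hfree _, Or.inr ?_⟩
    rw [H.unimodal.iterate_even hn, abs_sub_comm]
    exact le_trans (by linarith) (le_abs_self _)
  · have hbd : BddAbove Z := ⟨f 0, fun x hx => hx.2⟩
    obtain ⟨⟨e, he, he0⟩, hr⟩ := hcl.csSup_mem hne hbd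
    refine ⟨sSup Z, lt_of_le_of_ne hr ?_, ?_, Or.inl ⟨e, he, he0⟩⟩
    · intro e'
      exact H.iterate_f_zero_ne (n := e) (by omega) (e' ▸ he0)
    · intro i hi x hx h0
      exact absurd (le_csSup hbd ⟨⟨i, hi, h0⟩, hx.2.le⟩) (not_le.2 hx.1)

/-- If the left branch ends at a preimage `r` of order `e`, then its image is `f^(n-e-1)` of
the interval between the critical value and `f^(e+2) 0`, and is long when that interval contains
many intervals of the cycle. -/
theorem card_mul_le_left (H : PeriodicCycle f v h s) {μ : ℝ}
    (hμ : ∀ i, 1 ≤ i → i ≤ s → μ ≤ |f^[i] v - f^[i] 0|) {n e : ℕ} {r : ℝ} (hr : r < f 0)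
    (hF : CritFree f n r (f 0)) (he : e < n) (he0 : f^[e] r = 0) (S : Finset ℕ)
    (hS : ∀ i ∈ S, 1 ≤ i ∧ n - (e + 1) + i ≤ s ∧ ∀ x ∈ Icc 0 v, f^[i] x ≤ f^[e + 2] 0) :
    S.card * μ ≤ |f^[n] (f 0) - f^[n] r| := by
  obtain ⟨j, rfl⟩ : ∃ j, n = (e + 1) + j := ⟨n - (e + 1), by omega⟩
  have hr1 : f^[e + 1] r = f 0 := by rw [Function.iterate_succ_apply', he0]
  have hI := CritFree.image H.unimodal hr.le hF
  rw [hr1] at hI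
  have := H.card_mul_le hμ hI S (by
    intro i hi
    obtain ⟨h1, h2, h3⟩ := hS i hi
    exact ⟨h1, by omega, fun x hx => ⟨H.f_zero_le_iterate h1 x, h3 x hx⟩⟩)
  rw [add_comm (e + 1) j, Function.iterate_add_apply, Function.iterate_add_apply f j _ r, hr1]
  exact this

/-- The basic estimate: expansion of the cross-ratio of `r < f 0 < f v < y` under `f^n`. -/
theorem gap_lt (H : PeriodicCycle f v h s) {n : ℕ} (hns : n < s) {r y : ℝ} (hr : r < f 0)
    (hy : f v < y) (hl : CritFree f n r (f 0)) (hr' : CritFree f n (f 0) y) :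
    (f v - f 0) * (|f^[n] (f 0) - f^[n] r| * |f^[n] y - f^[n] (f v)|) <
      (y - f v) * (|f^[n + 1] v - f^[n + 1] 0| *
        (|f^[n] (f 0) - f^[n] r| + |f^[n + 1] v - f^[n + 1] 0| +
          |f^[n] y - f^[n] (f v)|)) := by
  have hF : CritFree f n r y := hl.trans hr' fun i hi => H.iterate_f_zero_ne (by omega)
  have key := H.unimodal.cross_mul_le hF hr H.f_zero_lt_f_v hy
  have h01 := H.f_zero_lt_f_v
  have inj := H.unimodal.injOn hF
  have p1 : 0 < |f^[n] (f 0) - f^[n] r| := abs_pos.2 (sub_ne_zero.2 fun e =>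
    hr.ne' (inj ⟨hr.le, by linarith⟩ ⟨le_rfl, by linarith⟩ e))
  have p2 : 0 < |f^[n] y - f^[n] (f v)| := abs_pos.2 (sub_ne_zero.2 fun e =>
    hy.ne' (inj ⟨by linarith, le_rfl⟩ ⟨by linarith, hy.le⟩ e))
  rw [Function.iterate_succ_apply, Function.iterate_succ_apply f n 0]
  set P := |f^[n] (f 0) - f^[n] r|
  set Q := |f^[n] y - f^[n] (f v)|
  set M := |f^[n] (f v) - f^[n] (f 0)|
  have hpos : 0 < (f v - f 0) * (P * Q) := mul_pos (by linarith) (mul_pos p1 p2)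
  have h1 : (f v - f 0) * (P * Q) * (f 0 - r) < (y - f v) * (M * (P + M + Q)) * (f 0 - r) := by
    have : (f v - f 0) * (P * Q) * (f 0 - r) < (f v - f 0) * (P * Q) * (y - r) :=
      mul_lt_mul_of_pos_left (by linarith) hpos
    linarith
  exact lt_of_mul_lt_mul_right h1 (by linarith)

/-- Suppose that the branch of `f^j` to the right of the critical value covers an interval
`f^t [0, v]` with reversed orientation, at distance less than `0.6` times the length of `f [0, v]`.
Then cross-ratio expansion on this smaller branch contradicts the basic estimate `h1`. -/
theorem nested_contradiction (H : PeriodicCycle f v h s) {μ R A y : ℝ} {j t : ℕ}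
    (hμ : ∀ i, 1 ≤ i → i ≤ s → μ ≤ |f^[i] v - f^[i] 0|) (hμ0 : 0 < μ) (hR : μ ≤ R)
    (hj : j + 1 ≤ s) (hjt : j + t ≤ s)
    (hF : CritFree f j (f 0) (f^[t] 0)) (hy : f v < y)
    (hpy : y ≤ f^[t] v) (hct : f^[t] v < f^[t] 0)
    (hA : |f^[j] (f^[t] v) - f^[j] (f 0)| ≤ A) (hgap : f^[t] 0 - f v < 0.6 * (f v - f 0))
    (h1 : (f v - f 0) * (R * A) < (y - f v) * (μ * (R + μ + A))) : False := by
  have h01 := H.f_zero_lt_f_v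
  have hlt : f v < f^[t] v := hy.trans_le hpy
  have key := H.unimodal.cross_mul_le hF h01 hlt hct
  have inj := H.unimodal.injOn hF
  have eA := H.unimodal.abs_add hF le_rfl h01.le hlt.le hct.le
  have k1 : |f^[j] (f v) - f^[j] (f 0)| = |f^[j + 1] v - f^[j + 1] 0| := rfl
  have k2 : |f^[j] (f^[t] 0) - f^[j] (f^[t] v)| = |f^[j + t] v - f^[j + t] 0| := by
    rw [abs_sub_comm, Function.iterate_add_apply, Function.iterate_add_apply f j t 0]
  have hAμ : μ ≤ A := by
    have := hμ (j + 1) (by omega) hj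
    linarith [abs_nonneg (f^[j] (f^[t] v) - f^[j] (f v))]
  refine cross_contradiction (m₁ := f v - f 0) (R := R) (A := A) (μ := μ)
    (u := |f^[j] (f v) - f^[j] (f 0)|) (g := |f^[j] (f^[t] v) - f^[j] (f v)|)
    (w := |f^[j] (f^[t] 0) - f^[j] (f^[t] v)|) (d := f^[t] v - f v) (β := f^[t] 0 - f^[t] v)
    (by linarith) hμ0 hR (by linarith) (k1 ▸ hμ _ (by omega) hj) ?_ ?_ (by linarith) (by linarith)
    (by linarith) ?_ ?_
  · rcases Nat.eq_zero_or_pos t with rfl | ht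
    · simp only [Function.iterate_zero, id] at hct
      linarith [H.pos]
    · exact k2 ▸ hμ _ (by omega) hjt
  · refine abs_pos.2 (sub_ne_zero.2 fun e => hlt.ne' (inj ⟨by linarith, hct.le⟩
      ⟨by linarith, by linarith⟩ e))
  · refine h1.trans_le (mul_le_mul_of_nonneg_right (by linarith) ?_)
    exact mul_nonneg hμ0.le (by linarith)
  · have e1 : f^[t] v - f v + (f v - f 0) + (f^[t] 0 - f^[t] v) = f^[t] 0 - f 0 := by ring
    have e2 : f v - f 0 + (f^[t] v - f v) + (f^[t] 0 - f^[t] v) = f^[t] 0 - f 0 := by ring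
    rw [e2]
    exact key

end PeriodicCycle

/-! ### The first turning value next to the leftmost interval -/

namespace PeriodicCycle
variable {f : ℝ → ℝ} {v h : ℝ} {s : ℕ}

theorem le_of_h_lt (H : PeriodicCycle f v h s) {i j : ℕ} (hi : 1 ≤ i) (his : i ≤ s)
    (hj : 1 ≤ j) (hjs : j ≤ s) (hlt : f^[i] h < f^[j] h) {x y : ℝ} (hx : x ∈ Icc 0 v)
    (hy : y ∈ Icc 0 v) : f^[i] x ≤ f^[j] y :=
  H.le_of_lt hi his hj hjs (fun e => hlt.ne (e ▸ rfl)) H.mem H.mem hlt hx hy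

/-- The case of three intervals in `card_mul_le`. -/
theorem three_mul_le (H : PeriodicCycle f v h s) {μ : ℝ}
    (hμ : ∀ i, 1 ≤ i → i ≤ s → μ ≤ |f^[i] v - f^[i] 0|) {n a b c : ℕ} {x y : ℝ}
    (hF : CritFree f n x y) (hab : a ≠ b) (hac : a ≠ c) (hbc : b ≠ c)
    (h0 : ∀ i ∈ ({a, b, c} : Finset ℕ), 1 ≤ i ∧ n + i ≤ s ∧
      ∀ t ∈ Icc 0 v, x ≤ f^[i] t ∧ f^[i] t ≤ y) : 3 * μ ≤ |f^[n] y - f^[n] x| := by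
  have := H.card_mul_le hμ hF {a, b, c} h0
  rw [Finset.card_eq_three.2 ⟨a, b, c, hab, hac, hbc, rfl⟩] at this
  exact_mod_cast this

/-- Let the branch of `f^n` around `f [0, v]` end on the right at a preimage `r'` of order `e` with
`r' ≤ f^(k+1) 0`. Its image beyond `f [0, v]` is then `f^(n-e-1)` of the interval between the
critical value and `f^(e+2) v`. This interval contains three intervals of the cycle, or
`nested_contradiction` applies to `f^(e+2) [0, v]` or `f^(k+1) [0, v]`, or `r'` lies in one of these
two intervals and is a point of the orbit of `h`. -/
theorem false_of_right_end_le (H : PeriodicCycle f v h s) (hs : 2 ≤ s) {k : ℕ} (hk : 1 ≤ k)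
    (hks : k < s) (hF : CritFree f (k - 1) (f 0) (f^[s - k + 1] h))
    (hren : ∀ n, 2 ≤ n → s = 2 * n → CritFree f (n - 1) (f 0) (f^[n + 1] h) → False)
    (hgap : f^[k + 1] 0 - f v < 0.6 * (f v - f 0))
    {μ : ℝ} (hμ : ∀ i, 1 ≤ i → i ≤ s → μ ≤ |f^[i] v - f^[i] 0|) (hμ0 : 0 < μ)
    (hcpk : f^[k + 1] v < f^[k + 1] 0)
    {n e : ℕ} (hns : n < s) {r' R : ℝ} (hr' : f v < r') (hFr : CritFree f n (f 0) r')
    (he : e < n) (he0 : f^[e] r' = 0) (hR : μ ≤ R) (hn1 : n = 1 → False)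
    (hle : r' ≤ f^[k + 1] 0)
    (h1 : (f v - f 0) * (R * |f^[n] r' - f^[n] (f v)|) <
      (r' - f v) * (μ * (R + μ + |f^[n] r' - f^[n] (f v)|))) : False := by
  have h01 := H.f_zero_lt_f_v
  obtain ⟨j, rfl⟩ : ∃ j, n = j + (e + 1) := ⟨n - (e + 1), by omega⟩
  have hFe : CritFree f e (f 0) r' := hFr.mono (by omega) le_rfl le_rfl
  have hr0 : f^[e + 1] r' = f 0 := by rw [Function.iterate_succ_apply', he0]
  have hr'0 : f 0 < r' := h01.trans hr'
  have hanti := H.unimodal.strictAntiOn_of_right hFe he0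
  have hct : f^[e + 2] v < f^[e + 2] 0 :=
    hanti ⟨le_rfl, hr'0.le⟩ ⟨h01.le, hr'.le⟩ h01
  have hFj : CritFree f j (f 0) (f^[e + 2] 0) := by
    have := CritFree.image_reverse H.unimodal (n := e + 1) (j := j) hr'0.le
      (hFr.mono (by omega) le_rfl le_rfl)
    rwa [hr0] at this
  have hA : |f^[j + (e + 1)] r' - f^[j + (e + 1)] (f v)| =
      |f^[j] (f^[e + 2] v) - f^[j] (f 0)| := by
    rw [Function.iterate_add_apply, hr0, abs_sub_comm, Function.iterate_add_apply]
    rfl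
  rw [hA] at h1
  have hVt : ∀ y ∈ Icc 0 v, f^[e + 2] v ≤ f^[e + 2] y ∧ f^[e + 2] y ≤ f^[e + 2] 0 := by
    intro y hy
    rcases H.unimodal.strictMonoOn_or (H.critFree.mono (show e + 2 ≤ s by omega) le_rfl le_rfl)
      with m | m
    · exact absurd (m H.zero_mem H.v_mem H.pos) (not_lt.2 hct.le)
    · exact ⟨m.antitoneOn hy H.v_mem hy.2, m.antitoneOn H.zero_mem hy hy.1⟩
  have hone : ∀ {i : ℕ}, 1 ≤ i → ∀ y, f 0 ≤ f^[i] y := fun hi y => H.f_zero_le_iterate hi y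
  have htv : f v < f^[e + 2] h := H.f_v_lt (by omega) (by omega)
  have hvt : f v ≤ f^[e + 2] v := H.f_v_le (by omega) (by omega) H.v_mem
  have hfx : ∀ x ∈ Icc 0 v, f x ≤ f v := fun x hx =>
    H.unimodal.mono.monotoneOn hx.1 H.pos.le hx.2
  -- indices of intervals to the left of `f^(e+2) 0` are small enough
  have hidx : ∀ {i : ℕ}, 1 ≤ i → i ≤ s → f^[i] h ≤ f^[e + 2] v → j + i ≤ s := by
    intro i hi his hi'
    rcases (hone hi h).lt_or_eq with hlt | heq
    · exact H.add_le_of_critFree hFj his hlt (hi'.trans_lt hct)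
    · by_cases hi1 : i = 1
      · omega
      · exact absurd (H.f_v_lt (by omega) his) (not_lt.2 (heq ▸ h01.le))
  have hthree : ∀ a b : ℕ, 2 ≤ a → 2 ≤ b → a ≠ b → a ≤ s → b ≤ s →
      (∀ y ∈ Icc 0 v, f^[a] y ≤ f^[e + 2] v) → (∀ y ∈ Icc 0 v, f^[b] y ≤ f^[e + 2] v) →
      False := by
    intro a b ha hb hab has hbs hav hbv
    have := H.three_mul_le hμ (n := j) (x := f 0) (y := f^[e + 2] v) (a := 1) (b := a) (c := b)
      (hFj.mono le_rfl le_rfl hct.le) (by omega) (by omega) hab (by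
        intro i hi
        simp only [Finset.mem_insert, Finset.mem_singleton] at hi
        rcases hi with rfl | rfl | rfl
        · exact ⟨le_rfl, by omega, fun t ht => ⟨hone le_rfl t, (hfx t ht).trans hvt⟩⟩
        · exact ⟨by omega, hidx (by omega) has (hav h H.mem),
            fun t ht => ⟨hone (by omega) t, hav t ht⟩⟩
        · exact ⟨by omega, hidx (by omega) hbs (hbv h H.mem),
            fun t ht => ⟨hone (by omega) t, hbv t ht⟩⟩)
    exact ratio_contradiction (by linarith) hμ0 (by linarith) h1 (Or.inr (Or.inr ⟨hR, this⟩))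
  rcases lt_or_ge (f^[e + 2] 0) r' with hcr | hcr
  · -- the reversed interval lies inside the branch, and so do its images under `f^(e+1)`
    obtain ⟨i1, v1⟩ := H.shift hFe he0 (i := e + 2) (by omega) (by omega)
      ((hVt h H.mem).2.trans_lt hcr) fun y hy => (hVt y hy).2.trans hcr.le
    obtain ⟨i2, v2⟩ := H.shift hFe he0 (i := e + 1 + (e + 2)) (by omega) i1
      ((v1 h H.mem).trans_lt (hct.trans hcr)) fun y hy => (v1 y hy).trans (hct.trans hcr).le
    exact hthree _ _ (by omega) (by omega) (by omega) i1 i2 v1 v2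
  rcases lt_or_ge (f^[e + 2] v) r' with hpr | hpr
  · -- the preimage `r'` lies in an interval of the cycle
    obtain ⟨x, hx, hxr⟩ := intermediate_value_Icc' H.pos.le
      (H.unimodal.iterate_cont (e + 2)).continuousOn (show r' ∈ Icc _ _ from ⟨hpr.le, hcr⟩)
    obtain ⟨hes, rfl⟩ := H.eq_of_iterate_eq_zero (n := e) (i := e + 2) (x := x) (by omega)
      (by omega) (by omega) hx (by rw [hxr, he0])
    refine hren (e + 1) ?_ (by omega) ?_
    · by_contra hcon
      exact hn1 (by omega)
    · rw [show e + 1 + 1 = e + 2 by ring, hxr]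
      exact hFe
  have hjs : j + 1 ≤ s := by omega
  by_cases htk : e + 2 = k + 1 ∨ f^[e + 2] h < f^[k + 1] h
  · refine H.nested_contradiction hμ hμ0 hR hjs (t := e + 2) (by omega) hFj hr' hpr hct le_rfl ?_ h1
    rcases htk with htk | htk
    · rw [htk]; exact hgap
    · have := H.le_of_h_lt (by omega) (by omega) (by omega) (by omega) htk H.zero_mem H.zero_mem
      linarith
  push Not at htk
  obtain ⟨htk1, htk2⟩ := htk
  have htk3 : f^[k + 1] h < f^[e + 2] h :=
    (H.iterate_h_lt_or (by omega) (by omega) (by omega) (by omega) htk1).resolve_left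
      (not_lt.2 htk2)
  have hV : ∀ y ∈ Icc 0 v, f^[k + 1] y ≤ f^[e + 2] v := fun y hy =>
    H.le_of_h_lt (by omega) (by omega) (by omega) (by omega) htk3 hy H.v_mem
  rcases le_or_gt r' (f^[k + 1] v) with hrk | hrk
  · refine H.nested_contradiction hμ hμ0 hR hjs (t := k + 1)
      (hidx (by omega) (by omega) (hV h H.mem))
      (hFj.mono le_rfl le_rfl ((hV 0 H.zero_mem).trans hct.le)) hr' hrk hcpk ?_ hgap h1
    exact H.unimodal.abs_le_abs (hFj.mono le_rfl le_rfl hct.le) le_rfl le_rfl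
      (hone (by omega) v) (hV v H.v_mem) le_rfl
  · -- the preimage `r'` is the point of the orbit of `h` in `f^(k+1) [0, v]`
    obtain ⟨x, hx, hxr⟩ := intermediate_value_Icc' H.pos.le
      (H.unimodal.iterate_cont (k + 1)).continuousOn (show r' ∈ Icc _ _ from ⟨hrk.le, hle⟩)
    obtain ⟨hes, rfl⟩ := H.eq_of_iterate_eq_zero (n := e) (i := k + 1) (x := x) (by omega)
      (by omega) (by omega) hx (by rw [hxr, he0])
    have hidx' : s - k + 1 = e + 2 := by omega
    rw [hidx'] at hF
    have hz0 : f^[k - 1] (f^[e + 2] x) = 0 := by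
      rw [← Function.iterate_add_apply, show k - 1 + (e + 2) = s by omega, H.zero]
    obtain ⟨i1, v1⟩ := H.shift hF hz0 (i := k + 1) (by omega) (by omega) htk3
      fun y hy => H.le_of_h_lt (by omega) (by omega) (by omega) (by omega) htk3 hy H.mem
    rw [show k - 1 + 2 = k + 1 by omega] at v1
    exact hthree (k + 1) (k - 1 + 1 + (k + 1)) (by omega) (by omega) (by omega) (by omega) i1 hV
      fun y hy => (v1 y hy).trans (hV v H.v_mem)

/-- Let the branch of `f^n` around `f [0, v]` extend on the right beyond `f^(k+1) 0`. Unless `s = 2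
* k`, two further intervals of the cycle lie between `f v` and `f^(k+1) 0`, or there is one there
and one to the left of `f^(e+2) 0`, which makes the left part of the image long. -/
theorem false_of_lt_right_end (H : PeriodicCycle f v h s) {k : ℕ} (hk : 1 ≤ k) (hks : k < s)
    (hF : CritFree f (k - 1) (f 0) (f^[s - k + 1] h))
    (hren : ∀ n, 2 ≤ n → s = 2 * n → CritFree f (n - 1) (f 0) (f^[n + 1] h) → False)
    (hgap : f^[k + 1] 0 - f v < 0.6 * (f v - f 0))
    {μ : ℝ} (hμ : ∀ i, 1 ≤ i → i ≤ s → μ ≤ |f^[i] v - f^[i] 0|) (hμ0 : 0 < μ)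
    (hVk : ∀ y ∈ Icc 0 v, f^[k + 1] v ≤ f^[k + 1] y ∧ f^[k + 1] y ≤ f^[k + 1] 0)
    {n e : ℕ} (hn : 1 ≤ n) {r r' : ℝ} (hFr : CritFree f n (f 0) r')
    (hr : r < f 0) (hFl : CritFree f n r (f 0)) (he : e < n) (he0 : f^[e] r = 0)
    (hlt : f^[k + 1] 0 < r')
    (h1 : (f v - f 0) * (|f^[n] (f 0) - f^[n] r| * |f^[n] (f^[k + 1] 0) - f^[n] (f v)|) <
      (f^[k + 1] 0 - f v) * (μ * (|f^[n] (f 0) - f^[n] r| + μ +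
        |f^[n] (f^[k + 1] 0) - f^[n] (f v)|))) : False := by
  have h01 := H.f_zero_lt_f_v
  have hm : 0 < f v - f 0 := by linarith
  have hone : ∀ {i : ℕ}, 1 ≤ i → ∀ y, f 0 ≤ f^[i] y := fun hi y => H.f_zero_le_iterate hi y
  have hfx : ∀ x ∈ Icc 0 v, f x ≤ f v := fun x hx =>
    H.unimodal.mono.monotoneOn hx.1 H.pos.le hx.2
  have hFA : CritFree f n (f v) (f^[k + 1] 0) := hFr.mono le_rfl h01.le hlt.le
  -- indices of intervals to the left of `f^(k+1) 0` are small enough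
  have hidx : ∀ {i : ℕ}, 2 ≤ i → i ≤ s → f^[i] h ≤ f^[k + 1] 0 → n + i ≤ s := fun hi his hi' =>
    H.add_le_of_critFree hFr his (h01.trans (H.f_v_lt hi his)) (hi'.trans_lt hlt)
  have hkn := hidx (i := k + 1) (by omega) (by omega) (hVk h H.mem).2
  have hR1 := H.card_mul_le_left hμ hr hFl he he0 {1} (by
    intro i hi
    rw [Finset.mem_singleton] at hi
    subst hi
    exact ⟨le_rfl, by omega, fun x hx => (hfx x hx).trans
      (H.f_v_le (by omega) (by omega) H.zero_mem)⟩)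
  rw [Finset.card_singleton, Nat.cast_one, one_mul] at hR1
  have hthree : ∀ a b : ℕ, 2 ≤ a → 2 ≤ b → a ≠ b → a ≠ k + 1 → b ≠ k + 1 → a ≤ s → b ≤ s →
      (∀ y ∈ Icc 0 v, f^[a] y ≤ f^[k + 1] 0) → (∀ y ∈ Icc 0 v, f^[b] y ≤ f^[k + 1] 0) →
      False := by
    intro a b ha hb hab hak hbk has hbs hav hbv
    have := H.three_mul_le hμ (n := n) (x := f v) (y := f^[k + 1] 0) (a := k + 1) (b := a) (c := b)
      hFA (Ne.symm hak) (Ne.symm hbk) hab (by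
        intro i hi
        simp only [Finset.mem_insert, Finset.mem_singleton] at hi
        rcases hi with rfl | rfl | rfl
        · exact ⟨by omega, hkn, fun t ht => ⟨H.f_v_le (by omega) (by omega) ht, (hVk t ht).2⟩⟩
        · exact ⟨by omega, hidx ha has (hav h H.mem), fun t ht => ⟨H.f_v_le ha has ht, hav t ht⟩⟩
        · exact ⟨by omega, hidx hb hbs (hbv h H.mem), fun t ht => ⟨H.f_v_le hb hbs ht, hbv t ht⟩⟩)
    exact ratio_contradiction hm hμ0 hgap.le h1 (Or.inr (Or.inr ⟨hR1, this⟩))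
  have hz0 : f^[k - 1] (f^[s - k + 1] h) = 0 := by
    rw [← Function.iterate_add_apply, show k - 1 + (s - k + 1) = s by omega, H.zero]
  by_cases hsk : s = 2 * k
  · refine hren k (by omega) hsk ?_
    rwa [show s - k + 1 = k + 1 by omega] at hF
  rcases H.iterate_h_lt_or (i := k + 1) (j := s - k + 1) (by omega) (by omega) (by omega) (by omega)
    (by omega) with hc | hc
  · obtain ⟨i1, v1⟩ := H.shift hF hz0 (i := k + 1) (by omega) (by omega) hc
      fun y hy => H.le_of_h_lt (by omega) (by omega) (by omega) (by omega) hc hy H.mem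
    rw [show k - 1 + 2 = k + 1 by omega] at v1
    have hvc : f^[k + 1] v ≤ f^[k + 1] h := (hVk h H.mem).1
    obtain ⟨i2, v2⟩ := H.shift hF hz0 (i := k - 1 + 1 + (k + 1)) (by omega) i1
      ((v1 h H.mem).trans_lt (hvc.trans_lt hc)) fun y hy => (v1 y hy).trans (hvc.trans hc.le)
    rw [show k - 1 + 2 = k + 1 by omega] at v2
    have hvc' := (hVk v H.v_mem).2
    exact hthree _ _ (by omega) (by omega) (by omega) (by omega) (by omega) i1 i2
      (fun y hy => (v1 y hy).trans hvc') fun y hy => (v2 y hy).trans hvc'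
  · have hVy : ∀ y ∈ Icc 0 v, f^[s - k + 1] y ≤ f^[k + 1] 0 := fun y hy =>
      H.le_of_h_lt (by omega) (by omega) (by omega) (by omega) hc hy H.zero_mem
    have hyn := hidx (i := s - k + 1) (by omega) (by omega) (hVy h H.mem)
    rcases H.iterate_h_lt_or (i := s - k + 1) (j := e + 2) (by omega) (by omega) (by omega)
      (by omega) (by omega) with hq | hq
    · have hR2 := H.card_mul_le_left hμ hr hFl he he0 {1, s - k + 1} (by
        intro i hi
        simp only [Finset.mem_insert, Finset.mem_singleton] at hi
        rcases hi with rfl | rfl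
        · exact ⟨le_rfl, by omega, fun x hx => (hfx x hx).trans
            (H.f_v_le (by omega) (by omega) H.zero_mem)⟩
        · exact ⟨by omega, by omega, fun x hx =>
            H.le_of_h_lt (by omega) (by omega) (by omega) (by omega) hq hx H.zero_mem⟩)
      have hA2 := H.card_mul_le hμ hFA {s - k + 1, k + 1} (by
        intro i hi
        simp only [Finset.mem_insert, Finset.mem_singleton] at hi
        rcases hi with rfl | rfl
        · exact ⟨by omega, hyn, fun t ht => ⟨H.f_v_le (by omega) (by omega) ht, hVy t ht⟩⟩
        · exact ⟨by omega, hkn, fun t ht => ⟨H.f_v_le (by omega) (by omega) ht, (hVk t ht).2⟩⟩)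
      rw [Finset.card_pair (by omega)] at hR2 hA2
      push_cast at hR2 hA2
      exact ratio_contradiction hm hμ0 hgap.le h1 (Or.inr (Or.inl ⟨hR2, hA2⟩))
    · have hVq : ∀ y ∈ Icc 0 v, f^[e + 2] y ≤ f^[k + 1] 0 := fun y hy =>
        (H.le_of_h_lt (by omega) (by omega) (by omega) (by omega) hq hy H.zero_mem).trans
          (hVy 0 H.zero_mem)
      exact hthree (s - k + 1) (e + 2) (by omega) (by omega) (by omega) (by omega) (by omega)
        (by omega) (by omega) hVy hVq

/-- The return map near the critical value has its next turning values of the form `f^(k+1) 0`,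
where `f^(k-1)` has no turning point between the critical value and the point `f^(s-k+1) h` of the
cycle. Such a value lies to the right of `f [0, v]`, at distance at least `0.6` times its length.
The hypothesis `hren` excludes the configuration in which the cycle comes from one of half the
period. -/
theorem le_gap (H : PeriodicCycle f v h s) {k : ℕ} (hk : 1 ≤ k) (hks : k < s)
    (hF : CritFree f (k - 1) (f 0) (f^[s - k + 1] h))
    (hren : ∀ n, 2 ≤ n → s = 2 * n → CritFree f (n - 1) (f 0) (f^[n + 1] h) → False) :
    0.6 * (f v - f 0) ≤ f^[k + 1] 0 - f v := by
  by_contra hgap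
  push Not at hgap
  have hs : 2 ≤ s := by omega
  have h01 := H.f_zero_lt_f_v
  have hm : 0 < f v - f 0 := by linarith
  have hz0 : f^[k - 1] (f^[s - k + 1] h) = 0 := by
    rw [← Function.iterate_add_apply, show k - 1 + (s - k + 1) = s by omega, H.zero]
  have hcpk : f^[k + 1] v < f^[k + 1] 0 := by
    have hx := H.f_v_lt (i := s - k + 1) (by omega) (by omega)
    have := H.unimodal.strictAntiOn_of_right hF hz0 ⟨le_rfl, by linarith⟩ ⟨h01.le, hx.le⟩ h01
    rwa [Nat.sub_add_cancel hk] at this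
  have hVk : ∀ y ∈ Icc 0 v, f^[k + 1] v ≤ f^[k + 1] y ∧ f^[k + 1] y ≤ f^[k + 1] 0 := by
    intro y hy
    rcases H.unimodal.strictMonoOn_or (H.critFree.mono (show k + 1 ≤ s by omega) le_rfl le_rfl)
      with m | m
    · exact absurd (m H.zero_mem H.v_mem H.pos) (not_lt.2 hcpk.le)
    · exact ⟨m.antitoneOn hy H.v_mem hy.2, m.antitoneOn H.zero_mem hy hy.1⟩
  have hvk : f v ≤ f^[k + 1] v := H.f_v_le (by omega) (by omega) H.v_mem
  -- compare with the shortest interval of the cycle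
  obtain ⟨m, hmI, hmin⟩ := (Finset.Icc 1 s).exists_min_image (fun i => |f^[i] v - f^[i] 0|)
    ⟨1, Finset.mem_Icc.2 ⟨le_rfl, H.one_le⟩⟩
  rw [Finset.mem_Icc] at hmI
  have hμ : ∀ i, 1 ≤ i → i ≤ s → |f^[m] v - f^[m] 0| ≤ |f^[i] v - f^[i] 0| := fun i h1 h2 =>
    hmin i (Finset.mem_Icc.2 ⟨h1, h2⟩)
  have hμ0 : 0 < |f^[m] v - f^[m] 0| :=
    abs_pos.2 (sub_ne_zero.2 fun e => H.pos.ne' (H.injOn hmI.2 H.v_mem H.zero_mem e))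
  rcases hmI.1.lt_or_eq with hm1 | rfl
  swap
  · have := hμ (k + 1) (by omega) (by omega)
    rw [Function.iterate_one, abs_of_pos hm, abs_sub_comm, abs_of_pos (by linarith)] at this
    linarith
  obtain ⟨n, rfl⟩ : ∃ n, m = n + 1 := ⟨m - 1, by omega⟩
  set μ := |f^[n + 1] v - f^[n + 1] 0| with hμdef
  have hn : 1 ≤ n := by omega
  have hns : n < s := by omega
  obtain ⟨r', hr', hFr, e', he', he0'⟩ := H.exists_right_end hs hn hns
  obtain ⟨r, hr, hFl, hend⟩ := H.exists_left_end hn hns (3 * μ)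
  have hy : f v < min r' (f^[k + 1] 0) := lt_min hr' (hvk.trans_lt hcpk)
  have h1 := H.gap_lt hns hr hy hFl (hFr.mono le_rfl le_rfl (min_le_left _ _))
  rw [← hμdef] at h1
  have hA : μ ≤ |f^[n] (min r' (f^[k + 1] 0)) - f^[n] (f v)| := by
    rcases le_or_gt r' (f^[k + 1] 0) with hle | hlt
    · -- the branch covers the image of `f [0, v]` under the remaining iterate
      rw [min_eq_left hle]
      obtain ⟨j, rfl⟩ : ∃ j, n = j + (e' + 1) := ⟨n - (e' + 1), by omega⟩
      have hr0 : f^[e' + 1] r' = f 0 := by rw [Function.iterate_succ_apply', he0']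
      have hI := CritFree.image_reverse H.unimodal (n := e' + 1) (j := j) hr'.le
        (hFr.mono (by omega) h01.le le_rfl)
      rw [hr0] at hI
      have hvt : f v ≤ f^[e' + 1] (f v) := H.f_v_le (i := e' + 2) (by omega) (by omega) H.v_mem
      have := H.unimodal.abs_le_abs hI le_rfl le_rfl h01.le hvt le_rfl
      rw [Function.iterate_add_apply, hr0, abs_sub_comm, Function.iterate_add_apply]
      exact (hμ (j + 1) (by omega) (by omega)).trans this
    · rw [min_eq_right hlt.le]
      have hkn := H.add_le_of_critFree hFr (i := k + 1) (by omega)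
        (h01.trans (H.f_v_lt (by omega) (by omega))) ((hVk h H.mem).2.trans_lt hlt)
      have := H.unimodal.abs_le_abs (hFr.mono le_rfl le_rfl hlt.le) (x := f v) h01.le hvk hcpk.le
        le_rfl le_rfl
      rw [abs_sub_comm (f^[n] (f^[k + 1] 0)) (f^[n] (f^[k + 1] v)), ← Function.iterate_add_apply,
        ← Function.iterate_add_apply] at this
      rw [← Function.iterate_add_apply f n (k + 1) 0]
      exact (hμ _ (by omega) hkn).trans this
  rcases hend with ⟨e, he, he0⟩ | hR
  swap
  · exact ratio_contradiction hm hμ0 (by linarith [min_le_right r' (f^[k + 1] 0)]) h1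
      (Or.inl ⟨hR, hA⟩)
  have hR1 := H.card_mul_le_left hμ hr hFl he he0 {1} (by
    intro i hi
    rw [Finset.mem_singleton] at hi
    subst hi
    exact ⟨le_rfl, by omega, fun x hx => (H.unimodal.mono.monotoneOn hx.1 H.pos.le hx.2).trans
      (H.f_v_le (by omega) (by omega) H.zero_mem)⟩)
  rw [Finset.card_singleton, Nat.cast_one, one_mul] at hR1
  rcases le_or_gt r' (f^[k + 1] 0) with hle | hlt
  · rw [min_eq_left hle] at h1
    refine H.false_of_right_end_le hs hk hks hF hren hgap hμ hμ0 hcpk hns hr' hFr he' he0' hR1 ?_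
      hle h1
    intro hn1
    have : e = 0 := by omega
    rw [this, Function.iterate_zero, id] at he0
    linarith [H.f_zero_le_neg hs, H.pos]
  · rw [min_eq_right hlt.le] at h1
    exact H.false_of_lt_right_end hk hks hF hren hgap hμ hμ0 hVk hn hFr hr hFl he he0 hlt h1

end PeriodicCycle

/-! ### Cycles that come from half the period -/

/-- A cycle of period `2 * n` whose intervals are paired by the `n`-th iterate. Up to the sign `ε`,
this iterate is a map `F` that decreases on `[0, e]`, with `e` the least preimage of the
critical point of order between `1` and `n - 1`, and that exchanges `v` and `F v`. -/
structure HalfPeriod (f : ℝ → ℝ) (v h : ℝ) (n : ℕ) (ε e : ℝ) (F : ℝ → ℝ) : Prop where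
  cycle : PeriodicCycle f v h (2 * n)
  two_le : 2 ≤ n
  sgn : ε = 1 ∨ ε = -1
  apply : ∀ x, F x = ε * f^[n] x
  anti : StrictAntiOn F (Icc 0 e)
  free : ∀ i, 1 ≤ i → i < n → ∀ x, |x| < e → f^[i] x ≠ 0
  zero : ∃ i, 1 ≤ i ∧ i < n ∧ f^[i] e = 0
  v_lt : v < e
  F_zero_lt : F 0 < e
  v_le : v ≤ F v
  F_F_v : F (F v) = v
  neg_v_le : -v ≤ F (F 0)
  F_F_zero_le : F (F 0) ≤ 0

/-- If `f^(n-1)` has no turning point between the critical value and `f^(n+1) h`, then `f^n` is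
monotone between `0` and the preimage `|f^n h|` of the critical point; `ε` is the sign of `f^n 0`.
-/
theorem PeriodicCycle.exists_halfPeriod {f : ℝ → ℝ} {v h : ℝ} {n : ℕ}
    (H : PeriodicCycle f v h (2 * n)) (hn : 2 ≤ n)
    (hfree : CritFree f (n - 1) (f 0) (f^[n + 1] h)) :
    ∃ ε e F, HalfPeriod f v h n ε e F := by
  have hv := H.pos
  have hc0 : f^[n] 0 ≠ 0 :=
    H.iterate_ne (by omega) (by omega) (PeriodicCycle.abs_le_of_mem H.zero_mem)
  obtain ⟨ε, hε, hC⟩ : ∃ ε : ℝ, (ε = 1 ∨ ε = -1) ∧ 0 < ε * f^[n] 0 := by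
    rcases hc0.lt_or_gt with k | k
    · exact ⟨-1, Or.inr rfl, by linarith⟩
    · exact ⟨1, Or.inl rfl, by linarith⟩
  have hεm : ∀ {i : ℕ}, 1 ≤ i → ∀ y, f^[i] (ε * y) = f^[i] y := by
    intro i hi y
    rcases hε with rfl | rfl
    · rw [one_mul]
    · rw [neg_one_mul, H.unimodal.iterate_even hi]
  have hεa : ∀ y, |ε * y| = |y| := by
    intro y
    rcases hε with rfl | rfl
    · rw [one_mul]
    · rw [neg_one_mul, abs_neg]
  set F : ℝ → ℝ := fun x => ε * f^[n] x with hF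
  have hFc : Continuous F := continuous_const.mul (H.unimodal.iterate_cont n)
  have hFF : ∀ x, F (F x) = ε * f^[2 * n] x := by
    intro x
    simp only [hF]
    rw [hεm (by omega), ← Function.iterate_add_apply, two_mul]
  have hFmono : ∀ {a b : ℝ}, CritFree f n a b →
      StrictMonoOn F (Icc a b) ∨ StrictAntiOn F (Icc a b) := by
    intro a b k
    rcases hε with rfl | rfl
    · simpa only [hF, one_mul] using H.unimodal.strictMonoOn_or k
    · have := (H.unimodal.strictMonoOn_or k).symm
      simp only [hF, neg_one_mul]
      exact this.imp (fun m => m.neg) fun m => m.neg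
  -- zeros of low order on `[0, ζ]`, where `ζ = |f^n h|`
  set ζ := |f^[n] h| with hζ
  have hvζ : v ≤ ζ := H.disj n (by omega) (by omega) h (PeriodicCycle.abs_le_of_mem H.mem)
  have hfζ : f ζ = f^[n + 1] h := by
    rw [hζ, H.unimodal.abs, Function.iterate_succ_apply']
  have free1 : ∀ i, 1 ≤ i → i < n → ∀ x, 0 < x → x < ζ → f^[i] x ≠ 0 := by
    intro i hi hin x hx hxζ
    rw [show i = i - 1 + 1 by omega, Function.iterate_succ_apply]
    refine hfree (i - 1) (by omega) _ ⟨H.f_zero_lt hx.ne', ?_⟩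
    rw [← hfζ]
    exact H.unimodal.mono hx.le (hx.le.trans hxζ.le) hxζ
  have crit1 : CritFree f n 0 ζ := by
    intro i hi x hx
    rcases Nat.eq_zero_or_pos i with rfl | hi0
    · exact hx.1.ne'
    · exact free1 i hi0 hi x hx.1 hx.2
  have hζ0 : 0 < ζ := hv.trans_le hvζ
  have hFζ : F ζ = 0 := by
    simp only [hF, hζ]
    rw [H.unimodal.iterate_abs (by omega), ← Function.iterate_add_apply, ← two_mul, H.zero,
      mul_zero]
  have anti1 : StrictAntiOn F (Icc 0 ζ) := by
    rcases hFmono crit1 with m | m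
    · have := m ⟨le_rfl, hζ0.le⟩ ⟨hζ0.le, le_rfl⟩ hζ0
      rw [hFζ] at this
      exact absurd this (not_lt.2 hC.le)
    · exact m
  have hFh : F h = ζ := by
    have h1 : 0 ≤ F h := hFζ ▸ anti1.antitoneOn ⟨H.mem.1, H.mem.2.trans hvζ⟩ ⟨hζ0.le, le_rfl⟩
      (H.mem.2.trans hvζ)
    rw [← abs_of_nonneg h1, hζ]
    exact hεa _
  have hFv0 : 0 ≤ F v := hFζ ▸ anti1.antitoneOn ⟨hv.le, hvζ⟩ ⟨hζ0.le, le_rfl⟩ hvζ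
  have hvF : v ≤ F v := by
    have := H.le_abs_iterate (n := n) (by omega)
    rw [← abs_of_nonneg hFv0]
    exact this.trans (hεa _).ge
  have hFvζ : F v < ζ := hFh ▸ anti1 ⟨H.mem.1, H.mem.2.trans hvζ⟩ ⟨hv.le, hvζ⟩ H.h_lt_v
  have hζC : ζ ≤ F 0 :=
    hFh ▸ anti1.antitoneOn ⟨le_rfl, hζ0.le⟩ ⟨H.mem.1, H.mem.2.trans hvζ⟩ H.mem.1
  have hFFv : F (F v) = v := by
    have h1 : 0 ≤ F (F v) := hFζ ▸ anti1.antitoneOn ⟨hFv0, hFvζ.le⟩ ⟨hζ0.le, le_rfl⟩ hFvζ.le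
    rw [← abs_of_nonneg h1, hFF, hεa, H.abs_iterate_s]
  -- up to sign, `[F v, F 0]` is `f^n [0, v]`, so its orbit stays in the cycle
  have free2 : ∀ i, 1 ≤ i → i < n → ∀ x, F v ≤ x → x ≤ F 0 → f^[i] x ≠ 0 := by
    intro i hi hin x hx hx'
    obtain ⟨t, ht, rfl⟩ := intermediate_value_Icc' hv.le hFc.continuousOn
      (show x ∈ Icc _ _ from ⟨hx, hx'⟩)
    simp only [hF]
    rw [hεm hi, ← Function.iterate_add_apply]
    exact H.iterate_ne (by omega) (by omega) (PeriodicCycle.abs_le_of_mem ht)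
  -- the first zero of low order
  set Z := {x | ∃ i < n - 1, f^[i] x = 0} with hZ
  set Y := f ⁻¹' Z ∩ Ici 0 with hY
  have hYc : IsClosed Y :=
    ((H.unimodal.isClosed_exists_zero (n - 1)).preimage H.unimodal.cont).inter isClosed_Ici
  have hYb : BddBelow Y := ⟨0, fun x hx => hx.2⟩
  have hYn : Y.Nonempty := by
    obtain ⟨x, hx, hx'⟩ := ((H.unimodal.tendsto.eventually_ge_atTop 0).and
      (eventually_ge_atTop 0)).exists
    have h0 := H.f_zero_le_neg (by omega)
    obtain ⟨t, ht, ht0⟩ := intermediate_value_Icc hx' H.unimodal.cont.continuousOn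
      (show (0 : ℝ) ∈ Icc _ _ from ⟨by linarith, hx⟩)
    exact ⟨t, ⟨0, by omega, ht0⟩, ht.1⟩
  obtain ⟨⟨i, hi, hi0⟩, he0⟩ := hYc.csInf_mem hYn hYb
  set e := sInf Y with he
  have hfreeY : ∀ i, 1 ≤ i → i < n → ∀ x, 0 ≤ x → x < e → f^[i] x ≠ 0 := by
    intro j hj hjn x hx hxe h0
    refine absurd (csInf_le hYb ⟨⟨j - 1, by omega, ?_⟩, hx⟩) (not_le.2 hxe)
    rwa [← Function.iterate_succ_apply, Nat.succ_eq_add_one, Nat.sub_add_cancel hj]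
  have hCe : F 0 < e := by
    by_contra hcon
    push Not at hcon
    have hi1 : f^[i + 1] e = 0 := by rwa [Function.iterate_succ_apply]
    rcases lt_or_ge e ζ with k | k
    · rcases (mem_Ici.1 he0).lt_or_eq with k' | k'
      · exact free1 (i + 1) (by omega) (by omega) e k' k hi1
      · rw [← k'] at hi1
        exact H.iterate_ne (by omega) (by omega) (PeriodicCycle.abs_le_of_mem H.zero_mem) hi1
    · exact free2 (i + 1) (by omega) (by omega) e (hFvζ.le.trans k) hcon hi1
  have crit2 : CritFree f n 0 e := by
    intro i hi x hx
    rcases Nat.eq_zero_or_pos i with rfl | hi0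
    · exact hx.1.ne'
    · exact hfreeY i hi0 hi x hx.1.le hx.2
  have hζe : ζ < e := hζC.trans_lt hCe
  refine ⟨ε, e, F, H, hn, hε, fun _ => rfl, ?_, ?_, ⟨i + 1, by omega, by omega, ?_⟩, by linarith,
    hCe, hvF, hFFv, ?_, ?_⟩
  · rcases hFmono crit2 with m | m
    · have := m ⟨le_rfl, by linarith⟩ ⟨hζ0.le, hζe.le⟩ hζ0
      rw [hFζ] at this
      exact absurd this (not_lt.2 hC.le)
    · exact m
  · intro i hi hin x hx
    rw [← H.unimodal.iterate_abs hi]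
    exact hfreeY i hi hin |x| (abs_nonneg x) hx
  · rwa [Function.iterate_succ_apply]
  · rw [hFF]
    have := H.inv 0 (PeriodicCycle.abs_le_of_mem H.zero_mem)
    rw [← hεa] at this
    exact (abs_le.1 this).1
  · -- `F ∘ F` is increasing on `[0, v]` and vanishes at `h`
    have k1 : F h ≤ F 0 := hζC.trans' hFh.le
    have h0 : F (F h) = 0 := by rw [hFh, hFζ]
    rcases hFmono crit2 with m | m
    · have := m ⟨le_rfl, by linarith⟩ ⟨hζ0.le, hζe.le⟩ hζ0
      rw [hFζ] at this
      exact absurd this (not_lt.2 hC.le)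
    · exact (m.antitoneOn ⟨by linarith, by linarith⟩ ⟨hC.le, hCe.le⟩ k1).trans_eq h0

namespace HalfPeriod
variable {f : ℝ → ℝ} {v h ε e : ℝ} {n : ℕ} {F : ℝ → ℝ}

theorem iterate_mul (T : HalfPeriod f v h n ε e F) {i : ℕ} (hi : 1 ≤ i) (y : ℝ) :
    f^[i] (ε * y) = f^[i] y := by
  rcases T.sgn with rfl | rfl
  · rw [one_mul]
  · rw [neg_one_mul, T.cycle.unimodal.iterate_even hi]

theorem abs_mul (T : HalfPeriod f v h n ε e F) (y : ℝ) : |ε * y| = |y| := by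
  rcases T.sgn with rfl | rfl
  · rw [one_mul]
  · rw [neg_one_mul, abs_neg]

theorem mul_mul (T : HalfPeriod f v h n ε e F) (y : ℝ) : ε * (ε * y) = y := by
  rcases T.sgn with rfl | rfl <;> ring

theorem continuous (T : HalfPeriod f v h n ε e F) : Continuous F := by
  rw [funext T.apply]
  exact continuous_const.mul (T.cycle.unimodal.iterate_cont n)

theorem even (T : HalfPeriod f v h n ε e F) (x : ℝ) : F (-x) = F x := by
  have := T.two_le
  rw [T.apply, T.apply, T.cycle.unimodal.iterate_even (by omega)]

theorem abs (T : HalfPeriod f v h n ε e F) (x : ℝ) : F |x| = F x := by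
  rcases abs_choice x with k | k <;> rw [k]
  exact T.even x

theorem apply_iterate (T : HalfPeriod f v h n ε e F) (i : ℕ) (x : ℝ) :
    F (ε * f^[i] x) = ε * f^[i + n] x := by
  have := T.two_le
  rw [T.apply, T.iterate_mul (by omega), ← Function.iterate_add_apply, add_comm]

theorem mono (T : HalfPeriod f v h n ε e F) : StrictMonoOn F (Icc (-e) 0) := by
  intro x hx y hy hxy
  rw [← T.even x, ← T.even y]
  exact T.anti ⟨by linarith [hy.2], by linarith [hy.1]⟩ ⟨by linarith [hx.2], by linarith [hx.1]⟩
    (by linarith)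

theorem v_pos (T : HalfPeriod f v h n ε e F) : 0 < v := T.cycle.pos

theorem F_v_lt (T : HalfPeriod f v h n ε e F) : F v < F 0 :=
  T.anti ⟨le_rfl, T.v_pos.le.trans T.v_lt.le⟩ ⟨T.v_pos.le, T.v_lt.le⟩ T.v_pos

/-- The images of the boundary point are fixed by `f^(2n)`. -/
theorem iterate_add_v (T : HalfPeriod f v h n ε e F) {i : ℕ} (hi : 1 ≤ i) :
    f^[i + n + n] v = f^[i] v := by
  rw [add_assoc, ← two_mul, Function.iterate_add_apply, ← T.cycle.unimodal.iterate_abs hi,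
    T.cycle.abs_iterate_s]

/-- `PeriodicCycle.le_or_le` in the coordinate `ε x`. -/
theorem le_or_le (T : HalfPeriod f v h n ε e F) {i j : ℕ} (hi : 1 ≤ i) (his : i ≤ 2 * n)
    (hj : 1 ≤ j) (hjs : j ≤ 2 * n) (hij : i ≠ j) :
    (∀ x ∈ Icc 0 v, ∀ y ∈ Icc 0 v, ε * f^[i] x ≤ ε * f^[j] y) ∨
      (∀ x ∈ Icc 0 v, ∀ y ∈ Icc 0 v, ε * f^[j] y ≤ ε * f^[i] x) := by
  have key := T.cycle.le_or_le hi his hj hjs hij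
  rcases T.sgn with rfl | rfl
  · simpa only [one_mul] using key
  · simpa only [neg_one_mul, neg_le_neg_iff] using key.symm

/-- The decreasing branch of `F` reaches the line `y = -x`. Otherwise the turning value `F e` would
be the end point `ε f^k 0` of an interval of the cycle inside `(-e, 0)`, on which `F` is increasing,
while `F` exchanges `ε f^k v` and `ε f^(k+n) v`. -/
theorem F_e_le (T : HalfPeriod f v h n ε e F) : F e ≤ -e := by
  by_contra hcon
  push Not at hcon
  have hn := T.two_le
  have hv := T.v_pos
  have H := T.cycle
  have he : 0 < e := hv.trans T.v_lt
  obtain ⟨j, hj, hjn, hj0⟩ := T.zero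
  obtain ⟨k, rfl⟩ : ∃ k, n = k + j := ⟨n - j, by omega⟩
  have hk : 1 ≤ k := by omega
  have hFe : F e = ε * f^[k] 0 := by
    rw [T.apply, Function.iterate_add_apply, hj0]
  have hFeC : F e < F (F 0) :=
    T.anti ⟨by linarith [T.v_le, T.F_v_lt], T.F_zero_lt.le⟩ ⟨he.le, le_rfl⟩ T.F_zero_lt
  have hFe0 : F e < 0 := hFeC.trans_le T.F_F_zero_le
  -- the whole interval `ε f^k [0, v]` lies to the left of `-v`
  have hP1 : ε * f^[k] v ≤ -v := by
    have side : (∀ x ∈ Icc 0 v, 0 ≤ ε * f^[k] x) ∨ (∀ x ∈ Icc 0 v, ε * f^[k] x ≤ 0) := by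
      have := H.unimodal.sign hv (fun y hy => H.critFree k (by omega) y hy)
      rcases T.sgn with rfl | rfl
      · simpa only [one_mul] using this
      · simpa only [neg_one_mul, Left.nonneg_neg_iff, Left.neg_nonpos_iff] using this.symm
    rcases side with m | m
    · exact absurd (m 0 H.zero_mem) (not_le.2 (hFe ▸ hFe0))
    · have h1 := H.le_abs_iterate hk
      rw [← T.abs_mul, abs_of_nonpos (m v H.v_mem)] at h1
      linarith
  -- `f^j` maps `[0, e]` onto half of `[-v, v]`
  obtain ⟨x, hx, hxv⟩ : ∃ x ∈ Icc 0 e, |f^[j] x| = v := by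
    have hc : Continuous fun x => |f^[j] x| := (H.unimodal.iterate_cont j).abs
    have h0 := H.disj j hj (by omega) 0 (PeriodicCycle.abs_le_of_mem H.zero_mem)
    exact intermediate_value_Icc' he.le hc.continuousOn
      (show v ∈ Icc _ _ from ⟨by simp only [hj0, abs_zero]; exact hv.le, h0⟩)
  have hFx : F x = ε * f^[k] v := by
    rw [T.apply, Function.iterate_add_apply, ← H.unimodal.iterate_abs hk, hxv]
  have hxe : x < e := by
    refine hx.2.lt_of_ne fun k' => ?_
    rw [k', hj0, abs_zero] at hxv
    exact hv.ne hxv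
  have hP1' : F e < ε * f^[k] v := hFx ▸ T.anti hx ⟨he.le, le_rfl⟩ hxe
  -- `F` exchanges `ε f^k v` and `ε f^(k+n) v`, and moves `[F e, ε f^k v]` to its right
  have hFP : F (ε * f^[k] v) = ε * f^[k + (k + j)] v := T.apply_iterate k v
  have hFQ : F (ε * f^[k + (k + j)] v) = ε * f^[k] v := by
    rw [T.apply_iterate, T.iterate_add_v hk]
  have hFc : F (ε * f^[k] 0) = ε * f^[k + (k + j)] 0 := T.apply_iterate k 0
  set P₁ := ε * f^[k] v
  set Q₁ := ε * f^[k + (k + j)] v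
  have hlow : F e < F (F e) := by
    rw [← T.even (F e)]
    exact T.anti ⟨by linarith, by linarith⟩ ⟨he.le, le_rfl⟩ (by linarith)
  have hord : P₁ ≤ ε * f^[k + (k + j)] 0 := by
    rcases T.le_or_le (i := k) (j := k + (k + j)) hk (by omega) (by omega) (by omega) (by omega)
      with m | m
    · exact m v H.v_mem 0 H.zero_mem
    · have := m 0 H.zero_mem 0 H.zero_mem
      rw [← hFc, ← hFe] at this
      linarith
  have hcQ : ε * f^[k + (k + j)] 0 < Q₁ := by
    rw [← hFc, ← hFP, ← hFe]
    exact T.mono ⟨hcon.le, hFe0.le⟩ ⟨by linarith, by linarith⟩ hP1'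
  rcases le_or_gt Q₁ 0 with hQ | hQ
  · have := T.mono ⟨by linarith, by linarith⟩ ⟨by linarith, hQ⟩ (hord.trans_lt hcQ)
    rw [hFP, hFQ] at this
    linarith
  · have hQC : Q₁ < F 0 := by
      rw [← hFP]
      exact T.mono ⟨by linarith, by linarith⟩ ⟨by linarith, le_rfl⟩ (by linarith)
    have := T.anti ⟨hQ.le, by linarith [T.F_zero_lt]⟩ ⟨by linarith, T.F_zero_lt.le⟩ hQC
    rw [hFQ] at this
    linarith [T.neg_v_le]

/-- The point `-a` is the first fixed point of `F` to the left of the critical point; it bounds the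
interval of period `n`. -/
theorem exists_fixed (T : HalfPeriod f v h n ε e F) :
    ∃ a, F 0 < a ∧ a ≤ e ∧ F a = -a ∧ ∀ x, |x| < a → -|x| < F x := by
  have hv := T.v_pos
  have h1 := T.F_v_lt
  have h2 := T.v_le
  have hCe := T.F_zero_lt
  have hc : Continuous fun x => F x + x := T.continuous.add continuous_id
  have low : ∀ x, 0 ≤ x → x ≤ F 0 → 0 < F x + x := by
    intro x hx hxC
    rcases le_or_gt x v with k | k
    · have := T.anti.antitoneOn ⟨hx, by linarith⟩ ⟨hv.le, T.v_lt.le⟩ k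
      linarith
    · have := T.anti.antitoneOn ⟨hx, by linarith⟩ ⟨by linarith, hCe.le⟩ hxC
      linarith [T.neg_v_le]
  set Z := {x | F x + x = 0} ∩ Icc (F 0) e with hZ
  have hZc : IsClosed Z := (isClosed_eq hc continuous_const).inter isClosed_Icc
  have hZb : BddBelow Z := ⟨F 0, fun x hx => hx.2.1⟩
  have hZn : Z.Nonempty := by
    obtain ⟨x, hx, hx0⟩ := intermediate_value_Icc' hCe.le hc.continuousOn
      (show (0 : ℝ) ∈ Icc _ _ from ⟨by linarith [T.F_e_le], (low _ (by linarith) le_rfl).le⟩)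
    exact ⟨x, hx0, hx⟩
  obtain ⟨h0, hCa, hae⟩ := hZc.csInf_mem hZn hZb
  have hCa' : F 0 < sInf Z := by
    refine hCa.lt_of_ne fun k => ?_
    have := low (sInf Z) (by linarith) k.ge
    exact this.ne' h0
  refine ⟨sInf Z, hCa', hae, by linarith [show F (sInf Z) + sInf Z = 0 from h0], ?_⟩
  intro x hx
  rw [← T.abs x]
  have hx0 := abs_nonneg x
  generalize |x| = y at hx hx0
  rcases le_or_gt y (F 0) with k | k
  · linarith [low y hx0 k]
  · by_contra hcon
    obtain ⟨t, ht, ht0⟩ := intermediate_value_Icc' k.le hc.continuousOn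
      (show (0 : ℝ) ∈ Icc _ _ from ⟨by linarith, (low _ (by linarith) le_rfl).le⟩)
    have := csInf_le hZb ⟨ht0, ht.1, by linarith [ht.2]⟩
    linarith [ht.2]

end HalfPeriod

theorem EvenUnimodal.exists_hasDerivAt_iterate {f : ℝ → ℝ} (hf : EvenUnimodal f) {n : ℕ} {x : ℝ}
    (h : ∀ i < n, f^[i] x ≠ 0) : ∃ d, d ≠ 0 ∧ HasDerivAt f^[n] d x := by
  induction n with
  | zero => exact ⟨1, one_ne_zero, hasDerivAt_id x⟩
  | succ n ih =>
    obtain ⟨d, hd, hd'⟩ := ih fun i hi => h i (hi.trans n.lt_succ_self)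
    obtain ⟨d', hd1, hd2⟩ := hf.diff _ (h n n.lt_succ_self)
    rw [Function.iterate_succ']
    exact ⟨d' * d, mul_ne_zero hd1 hd, hd2.comp x hd'⟩

namespace HalfPeriod
variable {f : ℝ → ℝ} {v h ε e : ℝ} {n : ℕ} {F : ℝ → ℝ}

theorem abs_F (T : HalfPeriod f v h n ε e F) (x : ℝ) : |F x| = |f^[n] x| := by
  rw [T.apply, T.abs_mul]

theorem abs_F_le (T : HalfPeriod f v h n ε e F) {a : ℝ} (ha : F 0 < a) (hae : a ≤ e)
    (hFa : F a = -a) {x : ℝ} (hx : |x| ≤ a) : |F x| ≤ a := by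
  rw [← T.abs x]
  have h0 := abs_nonneg x
  have h1 := T.anti.antitoneOn ⟨le_rfl, by linarith⟩ ⟨h0, hx.trans hae⟩ h0
  have h2 := T.anti.antitoneOn ⟨h0, hx.trans hae⟩ ⟨by linarith, hae⟩ hx
  exact abs_le.2 ⟨by linarith, by linarith⟩

/-- The first `n - 1` images of `[0, v]` stay outside `(-a, a)`. Otherwise `F` would exchange two
boundary points of the cycle inside `[-a, a]`: if both are negative, they coincide with `-a` and
two intervals of the cycle overlap; if not, both lie in `[v, F v]`, whose orbit avoids the critical
point. -/
theorem le_abs (T : HalfPeriod f v h n ε e F) {a : ℝ} (ha : F 0 < a) (hae : a ≤ e)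
    (hFa : F a = -a) (hlow : ∀ x, |x| < a → -|x| < F x) {m : ℕ} (hm : 1 ≤ m) (hmn : m < n)
    {x : ℝ} (hx : x ∈ Icc 0 v) : a ≤ |f^[m] x| := by
  by_contra hcon
  push Not at hcon
  have H := T.cycle
  have hv := T.v_pos
  have h1 := T.F_v_lt
  have h2 := T.v_le
  have ha0 : 0 < a := by linarith
  -- the boundary point of the image lies in `[-a, a]`, since `±a` are not interior
  have hp : |f^[m] v| ≤ a := by
    by_contra hpa
    push Not at hpa
    have hc : Continuous fun x => |f^[m] x| := (H.unimodal.iterate_cont m).abs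
    obtain ⟨t, ht, hta⟩ := intermediate_value_Ioo hx.2 hc.continuousOn
      (show a ∈ Ioo _ _ from ⟨hcon, hpa⟩)
    replace hta : |f^[m] t| = a := hta
    have ht' : t ∈ Ioo 0 v := ⟨hx.1.trans_lt ht.1, ht.2⟩
    have e1 : f^[n + m] t = f^[n] a := by
      rw [Function.iterate_add_apply, ← H.unimodal.iterate_abs (n := n) (by omega), hta]
    have e2 : |f^[m] t| = |f^[n + m] t| := by
      rw [e1, ← T.abs_F, hFa, hta, abs_neg, abs_of_pos ha0]
    have e3 : f^[m + 1] t = f^[n + m + 1] t := by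
      rw [Function.iterate_succ_apply', Function.iterate_succ_apply', H.unimodal.eq_iff, e2]
    exact H.iterate_ne_iterate (by omega) (by omega) (by omega) (by omega) (by omega)
      ⟨ht'.1.le, ht'.2.le⟩ ht' e3
  have hFP : F (ε * f^[m] v) = ε * f^[m + n] v := T.apply_iterate m v
  have hFQ : F (ε * f^[m + n] v) = ε * f^[m] v := by
    rw [T.apply_iterate, T.iterate_add_v hm]
  have hPv : v ≤ |ε * f^[m] v| := by rw [T.abs_mul]; exact H.le_abs_iterate hm
  have hQv : v ≤ |ε * f^[m + n] v| := by rw [T.abs_mul]; exact H.le_abs_iterate (by omega)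
  have hPa : |ε * f^[m] v| ≤ a := by rw [T.abs_mul]; exact hp
  have hQa : |ε * f^[m + n] v| ≤ a := hFP ▸ T.abs_F_le ha hae hFa hPa
  have hxa : |ε * f^[m] x| < a := by rw [T.abs_mul]; exact hcon
  have hFx : F (ε * f^[m] x) = ε * f^[m + n] x := T.apply_iterate m x
  have hord := T.le_or_le (i := m) (j := m + n) hm (by omega) (by omega) (by omega) (by omega)
  by_cases hneg : ε * f^[m] v ≤ 0 ∧ ε * f^[m + n] v ≤ 0
  · obtain ⟨hP0, hQ0⟩ := hneg
    set P₁ := ε * f^[m] v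
    set Q₁ := ε * f^[m + n] v
    have hPI : P₁ ∈ Icc (-e) 0 := ⟨by linarith [(abs_le.1 hPa).1], hP0⟩
    have hQI : Q₁ ∈ Icc (-e) 0 := ⟨by linarith [(abs_le.1 hQa).1], hQ0⟩
    have hPQ : P₁ = Q₁ := by
      rcases lt_trichotomy P₁ Q₁ with k | k | k
      · have := T.mono hPI hQI k
        linarith
      · exact k
      · have := T.mono hQI hPI k
        linarith
    have hPa' : P₁ = -a := by
      by_contra hne
      have hlt : |P₁| < a := by
        rw [abs_of_nonpos hP0]
        have := (abs_le.1 hPa).1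
        linarith [this.lt_of_ne (Ne.symm hne)]
      have := hlow P₁ hlt
      rw [abs_of_nonpos hP0] at this
      linarith
    -- both images extend to the right of their common boundary point `-a`
    have k1 : -a < ε * f^[m] x := (abs_lt.1 hxa).1
    have k2 : -a < ε * f^[m + n] x := by
      have := hlow _ hxa
      rw [hFx] at this
      linarith
    rcases hord with k | k
    · have := k x hx v H.v_mem
      linarith
    · have := k v H.v_mem x hx
      linarith
  · have key : ∀ X Y, 0 < X → F X = Y → F Y = X → v ≤ |X| → v ≤ |Y| → |X| ≤ a → |Y| ≤ a →
        (v ≤ X ∧ X ≤ F v) ∧ (v ≤ Y ∧ Y ≤ F v) := by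
      intro X Y hX hXY hYX hvX hvY hXa hYa
      have bound : ∀ Z, v ≤ |Z| → |Z| ≤ a → F Z ≤ F v := by
        intro Z h1 h2
        rw [← T.abs Z]
        exact T.anti.antitoneOn ⟨hv.le, T.v_lt.le⟩ ⟨abs_nonneg Z, h2.trans hae⟩ h1
      rw [abs_of_pos hX] at hvX
      have hXF : X ≤ F v := hYX ▸ bound Y hvY hYa
      have hY : v ≤ Y := by
        have := T.anti.antitoneOn ⟨hX.le, by linarith [T.F_zero_lt]⟩
          ⟨by linarith, by linarith [T.F_zero_lt]⟩ hXF
        rwa [hXY, T.F_F_v] at this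
      exact ⟨⟨hvX, hXF⟩, hY, hXY ▸ bound X (by rwa [abs_of_pos hX]) hXa⟩
    obtain ⟨hP1, hP2⟩ : v ≤ ε * f^[m] v ∧ ε * f^[m] v ≤ F v := by
      rcases not_and_or.1 hneg with k | k
      · exact (key _ _ (not_le.1 k) hFP hFQ hPv hQv hPa hQa).1
      · exact (key _ _ (not_le.1 k) hFQ hFP hQv hPv hQa hPa).2
    -- then the zero of the return map is trapped in `[v, F v]`
    have hz2 : ε * f^[m] h ≤ F v := by
      rcases T.le_or_le (i := m) (j := n) hm (by omega) (by omega) (by omega) (by omega)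
        with k | k
      · exact (k h H.mem v H.v_mem).trans_eq (T.apply v).symm
      · have := k v H.v_mem 0 H.zero_mem
        rw [← T.apply 0] at this
        linarith
    have hz1 : v ≤ ε * f^[m] h := by
      have side := H.unimodal.sign hv (fun y hy => H.critFree m (by omega) y hy)
      have hva := H.disj m hm (by omega) h (PeriodicCycle.abs_le_of_mem H.mem)
      rw [← T.abs_mul] at hva
      have : 0 ≤ ε * f^[m] h := by
        rcases T.sgn with k | k <;> subst k <;> rcases side with k | k
        · rw [one_mul]; exact k h H.mem
        · have := k v H.v_mem; linarith
        · have := k v H.v_mem; linarith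
        · have := k h H.mem; linarith
      rwa [abs_of_nonneg this] at hva
    set Z := ε * f^[m] h with hZ
    have hZe : |Z| < e := by
      rw [abs_of_nonneg (by linarith)]
      linarith [T.F_zero_lt]
    have hZ0 : ∀ i, 1 ≤ i → f^[i] Z = f^[i + m] h := by
      intro i hi
      rw [hZ, T.iterate_mul hi, ← Function.iterate_add_apply]
    have hz0 : f^[2 * n - m] Z = 0 := by
      rw [hZ0 _ (by omega), show 2 * n - m + m = 2 * n by omega, H.zero]
    have hFZ : v ≤ F Z ∧ F Z ≤ F v := by
      constructor
      · rw [← T.F_F_v]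
        exact T.anti.antitoneOn ⟨by linarith, by linarith [T.F_zero_lt]⟩
          ⟨by linarith, by linarith [T.F_zero_lt]⟩ hz2
      · exact T.anti.antitoneOn ⟨hv.le, T.v_lt.le⟩
          ⟨by linarith, by linarith [T.F_zero_lt]⟩ hz1
    refine T.free (n - m) (by omega) (by omega) (F Z) ?_ ?_
    · rw [abs_of_nonneg (by linarith)]
      linarith [T.F_zero_lt]
    · rw [T.apply, T.iterate_mul (by omega), ← Function.iterate_add_apply,
        show n - m + n = 2 * n - m by omega, hz0]

/-- The point `a` never returns to `(-a, a)`: otherwise its orbit would contain two fixed points of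
`F` with the same multiplier, one where `F` increases and one where it decreases. -/
theorem hasNiceBoundary (T : HalfPeriod f v h n ε e F) {a : ℝ} (ha : F 0 < a) (hae : a ≤ e)
    (hFa : F a = -a) (hlow : ∀ x, |x| < a → -|x| < F x) : HasNiceBoundary f a := by
  have H := T.cycle
  have hn := T.two_le
  have hv := T.v_pos
  have h1 := T.F_v_lt
  have h2 := T.v_le
  have ha0 : 0 < a := by linarith
  refine ⟨ha0, fun k hk hin => ?_⟩
  have hfn : f^[n] (-a) = ε * -a := by
    rw [← T.mul_mul (f^[n] (-a)), ← T.apply, T.even, hFa]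
  have hfix : ∀ i, f^[i + 1] (f^[n] (-a)) = f^[i + 1] (-a) := fun i => by
    rw [hfn, T.iterate_mul (by omega)]
  -- the orbit of `-a` misses the critical point
  have horb : ∀ i, f^[i] (-a) ≠ 0 := by
    intro i hi
    rcases Nat.eq_zero_or_pos i with rfl | hi0
    · rw [Function.iterate_zero, id] at hi
      linarith
    · obtain ⟨i, rfl⟩ : ∃ i', i = i' + 1 := ⟨i - 1, by omega⟩
      have : f^[n] (f^[i + 1] (-a)) = f^[i + 1] (-a) := by
        rw [(Function.Commute.iterate_iterate_self f n (i + 1)).eq, hfix]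
      rw [hi] at this
      have h3 : F 0 = 0 := by rw [T.apply, this, mul_zero]
      linarith
  set u := ε * f^[k] (-a) with hu
  have huk : ∀ i, 1 ≤ i → f^[i] u = f^[i + k] (-a) := fun i hi => by
    rw [hu, T.iterate_mul hi, ← Function.iterate_add_apply]
  have hFu : F u = u := by
    obtain ⟨k, rfl⟩ : ∃ k', k = k' + 1 := ⟨k - 1, by omega⟩
    rw [T.apply, huk n (by omega), Function.iterate_add_apply,
      (Function.Commute.iterate_iterate_self f n (k + 1)).eq, hfix]
  have hua : |u| < a := by
    rw [hu, T.abs_mul, H.unimodal.iterate_even hk]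
    exact abs_lt.2 hin
  have hu0 : 0 < u := by
    by_contra hcon
    have := hlow u hua
    rw [hFu, abs_of_nonpos (not_lt.1 hcon)] at this
    linarith
  have hue : u ≤ e := by linarith [(abs_lt.1 hua).2]
  obtain ⟨d₁, hd₁, hD₁⟩ := H.unimodal.exists_hasDerivAt_iterate (n := n) fun i _ => horb i
  obtain ⟨d₂, hd₂, hD₂⟩ := H.unimodal.exists_hasDerivAt_iterate (n := n) (x := u) (by
    intro i _
    rcases Nat.eq_zero_or_pos i with rfl | hi0
    · exact hu0.ne'
    · rw [huk i hi0]; exact horb _)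
  obtain ⟨d₃, hd₃, hD₃⟩ := H.unimodal.exists_hasDerivAt_iterate (n := k) fun i _ => horb i
  have hε : ε ≠ 0 := by rcases T.sgn with k | k <;> rw [k] <;> norm_num
  have hF₁ : HasDerivAt F (ε * d₁) (-a) := by
    rw [funext T.apply]; exact hD₁.const_mul ε
  have hF₂ : HasDerivAt F (ε * d₂) u := by
    rw [funext T.apply]; exact hD₂.const_mul ε
  have hφ : HasDerivAt (fun x => ε * f^[k] x) (ε * d₃) (-a) := hD₃.const_mul ε
  have hFa' : F (-a) = -a := by rw [T.even, hFa]
  -- the chain rule for the two ways of writing `F ∘ f^k`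
  have hc₁ : HasDerivAt (fun x => F (ε * f^[k] x)) (ε * d₂ * (ε * d₃)) (-a) :=
    HasDerivAt.comp (-a) (h₂ := F) hF₂ hφ
  have hc₂ : HasDerivAt (fun x => ε * f^[k] (F x)) (ε * d₃ * (ε * d₁)) (-a) :=
    HasDerivAt.comp (-a) (h₂ := fun x => ε * f^[k] x) (by rwa [hFa']) hF₁
  have hcomm : (fun x => F (ε * f^[k] x)) = fun x => ε * f^[k] (F x) := by
    funext x
    rw [T.apply_iterate, T.apply, T.iterate_mul hk, add_comm, Function.iterate_add_apply,
      (Function.Commute.iterate_iterate_self f n k).eq]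
  rw [hcomm] at hc₁
  have heq : ε * d₂ = ε * d₁ :=
    mul_left_cancel₀ (mul_ne_zero hε hd₃) ((mul_comm _ _).trans (hc₁.unique hc₂))
  have he : 0 < e := by linarith
  have s₁ : 0 ≤ ε * d₁ := by
    have := T.mono.monotoneOn.derivWithin_nonneg (x := -a)
    rwa [hF₁.hasDerivWithinAt.derivWithin
      (uniqueDiffOn_Icc (by linarith) _ ⟨by linarith, by linarith⟩)] at this
  have s₂ : ε * d₂ ≤ 0 := by
    have := T.anti.antitoneOn.derivWithin_nonpos (x := u)
    rwa [hF₂.hasDerivWithinAt.derivWithin (uniqueDiffOn_Icc he _ ⟨hu0.le, hue⟩)] at this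
  exact mul_ne_zero hε hd₁ (le_antisymm (heq ▸ s₂) s₁)

end HalfPeriod

/-- If `f^(n-1)` has no turning point between the critical value and `f^(n+1) h`, the interval
`[-a, a]` of `HalfPeriod.exists_fixed` is periodic of period `n`. -/
theorem PeriodicCycle.isRenormalizable {f : ℝ → ℝ} {v h : ℝ} {n : ℕ}
    (H : PeriodicCycle f v h (2 * n)) (hn : 2 ≤ n)
    (hfree : CritFree f (n - 1) (f 0) (f^[n + 1] h)) : IsRenormalizable f n := by
  obtain ⟨ε, e, F, T⟩ := H.exists_halfPeriod hn hfree
  obtain ⟨a, ha, hae, hFa, hlow⟩ := T.exists_fixed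
  have hv := H.pos
  have ha0 : 0 < a := by linarith [T.F_v_lt, T.v_le]
  have hmaps : Icc (-a) a ⊆ f^[n] ⁻¹' Icc (-a) a := fun x hx => by
    rw [mem_preimage, mem_Icc, ← abs_le, ← T.abs_F]
    exact T.abs_F_le ha hae hFa (abs_le.2 hx)
  refine ⟨hn, a, T.hasNiceBoundary ha hae hFa hlow, ⟨0, by linarith, ha0.le⟩, ?_, ?_⟩
  · have hset : returnSet f (Icc (-a) a) = Ioo (-a) a := by
      ext x
      simp only [returnSet, interior_Icc, mem_ofPred_eq]
      exact ⟨fun hx => hx.1, fun hx => ⟨hx, n, by omega,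
        Filter.mem_of_superset (Icc_mem_nhds hx.1 hx.2) hmaps⟩⟩
    rw [centralDomain, hset, isPreconnected_Ioo.connectedComponentIn ⟨by linarith, ha0⟩,
      closure_Ioo (by linarith)]
  · refine le_antisymm (Nat.sInf_le ⟨by omega, Filter.mem_of_superset
      (Icc_mem_nhds (by linarith) ha0) hmaps⟩) ?_
    refine le_csInf ⟨n, by omega, Filter.mem_of_superset
      (Icc_mem_nhds (by linarith) ha0) hmaps⟩ ?_
    rintro m ⟨hm, hm0⟩
    by_contra hmn
    push Not at hmn
    -- otherwise `f^m` would map all points near `0` to `±a`, against injectivity on `[0, v]`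
    obtain ⟨δ, hδ, hball⟩ := Metric.mem_nhds_iff.1 hm0
    set x := min (δ / 2) (v / 2) with hx
    have hx0 : 0 < x := lt_min (by linarith) (by linarith)
    have hxv : x < v := (min_le_right _ _).trans_lt (by linarith)
    have hval : ∀ y ∈ Icc 0 x, |f^[m] y| = a := by
      intro y hy
      have h1 : y ∈ Metric.ball (0 : ℝ) δ := by
        rw [Metric.mem_ball, Real.dist_eq, sub_zero, abs_of_nonneg hy.1]
        exact (hy.2.trans (min_le_left _ _)).trans_lt (by linarith)
      exact le_antisymm (abs_le.2 (hball h1))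
        (T.le_abs ha hae hFa hlow hm hmn ⟨hy.1, hy.2.trans hxv.le⟩)
    have hinj := H.injOn (n := m + 1) (by omega) ⟨le_rfl, hv.le⟩ ⟨hx0.le, hxv.le⟩ (by
      rw [Function.iterate_succ_apply', Function.iterate_succ_apply', H.unimodal.eq_iff,
        hval 0 ⟨le_rfl, hx0.le⟩, hval x ⟨hx0.le, le_rfl⟩])
    exact hx0.ne hinj

/-! ### Central domains and periodic intervals -/

namespace EvenUnimodal
variable {f : ℝ → ℝ}

theorem isOpen_returnSet (f : ℝ → ℝ) (A : Set ℝ) : IsOpen (returnSet f A) := by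
  have : returnSet f A = interior A ∩ ⋃ n ≥ 1, interior (f^[n] ⁻¹' A) := by
    ext x
    simp [returnSet, mem_interior_iff_mem_nhds]
  rw [this]
  exact isOpen_interior.inter (isOpen_biUnion fun _ _ => isOpen_interior)

theorem neg_mem_returnSet (hf : EvenUnimodal f) {b x : ℝ} (hx : x ∈ returnSet f (Icc (-b) b)) :
    -x ∈ returnSet f (Icc (-b) b) := by
  obtain ⟨hx, n, hn, hx'⟩ := hx
  rw [interior_Icc] at hx
  refine ⟨by rw [interior_Icc]; exact ⟨by linarith [hx.2], by linarith [hx.1]⟩, n, hn, ?_⟩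
  have hc : ContinuousAt (fun y : ℝ => -y) (-x) := continuous_neg.continuousAt
  have := hc.preimage_mem_nhds (t := f^[n] ⁻¹' Icc (-b) b) (by rwa [neg_neg])
  refine Filter.mem_of_superset this fun y hy => ?_
  rw [mem_preimage, ← hf.iterate_even hn]
  exact hy

/-- The central domain of the first return map to a symmetric interval is a symmetric interval. -/
theorem exists_centralDomain_eq (hf : EvenUnimodal f) {b : ℝ} (hb : 0 < b)
    (h0 : 0 ∈ returnSet f (Icc (-b) b)) :
    ∃ v, 0 < v ∧ v ≤ b ∧ centralDomain f (Icc (-b) b) = Icc (-v) v ∧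
      Ioo (-v) v ⊆ returnSet f (Icc (-b) b) ∧ v ∉ returnSet f (Icc (-b) b) := by
  set R := returnSet f (Icc (-b) b) with hR
  set Z := Rᶜ ∩ Ici 0 with hZ
  have hZc : IsClosed Z := (isOpen_returnSet f _).isClosed_compl.inter isClosed_Ici
  have hZb : BddBelow Z := ⟨0, fun x hx => hx.2⟩
  have hbZ : b ∈ Z := ⟨fun h => by
    have := h.1
    rw [interior_Icc] at this
    exact lt_irrefl _ this.2, hb.le⟩
  obtain ⟨hv, hv0⟩ := hZc.csInf_mem ⟨b, hbZ⟩ hZb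
  set v := sInf Z with hvdef
  have hv0' : 0 < v := lt_of_le_of_ne hv0 fun e => hv (e ▸ h0)
  have hpos : ∀ x, 0 ≤ x → x < v → x ∈ R := by
    intro x hx hxv
    by_contra hcon
    exact absurd (csInf_le hZb ⟨hcon, hx⟩) (not_le.2 hxv)
  have hsub : Ioo (-v) v ⊆ R := by
    intro x hx
    rcases le_total 0 x with k | k
    · exact hpos x k hx.2
    · have := hf.neg_mem_returnSet (hpos (-x) (by linarith) (by linarith [hx.1]))
      rwa [neg_neg] at this
  refine ⟨v, hv0', csInf_le hZb hbZ, ?_, hsub, hv⟩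
  have hmem : (0 : ℝ) ∈ Ioo (-v) v := ⟨by linarith, hv0'⟩
  have : connectedComponentIn R 0 = Ioo (-v) v := by
    apply Subset.antisymm
    · intro x hx
      have hord := (isPreconnected_connectedComponentIn (x := (0 : ℝ)) (F := R)).ordConnected
      have h0K := mem_connectedComponentIn h0
      have hKR := connectedComponentIn_subset R 0
      constructor
      · by_contra hcon
        push Not at hcon
        have := hf.neg_mem_returnSet (hKR (hord.out hx h0K ⟨hcon, by linarith⟩))
        rw [neg_neg] at this
        exact hv this
      · by_contra hcon
        push Not at hcon
        exact hv (hKR (hord.out h0K hx ⟨hv0, hcon⟩))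
    · exact isPreconnected_Ioo.subset_connectedComponentIn hmem hsub
  rw [centralDomain, this, closure_Ioo (by linarith)]

/-- If `f^n` maps a neighbourhood of `y` into `[-v, v]` and `y` to its boundary, then `f^n` has a
local extremum at `y`, so the orbit of `y` meets the critical point before time `n`. -/
theorem exists_iterate_eq_zero (hf : EvenUnimodal f) {v y : ℝ} {n : ℕ}
    (hn : f^[n] ⁻¹' Icc (-v) v ∈ 𝓝 y) (hy : |f^[n] y| = v) : ∃ i < n, f^[i] y = 0 := by
  by_contra hcon
  push Not at hcon
  obtain ⟨d, hd, hD⟩ := hf.exists_hasDerivAt_iterate hcon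
  rcases abs_choice (f^[n] y) with k | k <;> rw [hy] at k
  · refine hd (IsLocalMax.hasDerivAt_eq_zero ?_ hD)
    filter_upwards [hn] with x hx
    exact k ▸ hx.2
  · refine hd (IsLocalMin.hasDerivAt_eq_zero ?_ hD)
    filter_upwards [hn] with x hx
    linarith [hx.1]

end EvenUnimodal

/-- A periodic interval with nice boundary points in which some point reaches the critical point
within one period is a cycle of intervals, and it takes the point exactly one period. -/
theorem EvenUnimodal.periodicCycle {f : ℝ → ℝ} (hf : EvenUnimodal f) {v x : ℝ} {s : ℕ}
    (hv : 0 < v) (hnice : ∀ n, 1 ≤ n → f^[n] v ∉ Ioo (-v) v)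
    (hR : Ioo (-v) v ⊆ returnSet f (Icc (-v) v)) (hs : centralTime f (Icc (-v) v) = s)
    (hx : |x| ≤ v) (N : ℕ) (hN : 1 ≤ N) (hNs : N ≤ s) (hx0 : f^[N] x = 0) :
    N = s ∧ PeriodicCycle f v |x| s := by
  have hne : {n : ℕ | 1 ≤ n ∧ f^[n] ⁻¹' Icc (-v) v ∈ 𝓝 (0 : ℝ)}.Nonempty := by
    obtain ⟨-, n, hn⟩ := hR ⟨by linarith, hv⟩
    exact ⟨n, hn⟩
  have hsmem := Nat.sInf_mem hne
  rw [show sInf _ = s from hs] at hsmem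
  obtain ⟨hs1, hs0⟩ := hsmem
  have hmin : ∀ n, 1 ≤ n → n < s → f^[n] ⁻¹' Icc (-v) v ∉ 𝓝 (0 : ℝ) := by
    intro n hn hns h
    have : s ≤ n := hs ▸ Nat.sInf_le ⟨hn, h⟩
    omega
  have hcl : closure (Ioo 0 v) = Icc 0 v := closure_Ioo hv.ne
  have hvn : ∀ n, 1 ≤ n → v ≤ |f^[n] v| := by
    intro n hn
    by_contra hcon
    exact hnice n hn (abs_lt.1 (not_le.1 hcon))
  -- no interior point hits the boundary as long as the earlier images avoid the interior
  have hB : ∀ i, 1 ≤ i → (∀ j, 1 ≤ j → j < i → ∀ x ∈ Icc 0 v, v ≤ |f^[j] x|) →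
      ∀ y ∈ Ioo 0 v, |f^[i] y| ≠ v := by
    intro i hi hA y hy hyv
    have horb : ∀ j, 1 ≤ j → v ≤ |f^[j] y| := by
      intro j hj
      rcases lt_trichotomy j i with k | rfl | k
      · exact hA j hj k y ⟨hy.1.le, hy.2.le⟩
      · exact hyv.ge
      · have := hvn (j - i) (by omega)
        rw [← hyv, hf.iterate_abs (by omega), ← Function.iterate_add_apply,
          Nat.sub_add_cancel k.le] at this
        rwa [hyv] at this
    obtain ⟨-, n, hn, hn'⟩ := hR ⟨by linarith [hy.1], hy.2⟩
    obtain ⟨j, -, hj0⟩ := hf.exists_iterate_eq_zero hn'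
      (le_antisymm (abs_le.2 (mem_of_mem_nhds hn' :)) (horb n hn))
    rcases Nat.eq_zero_or_pos j with rfl | hj
    · exact hy.1.ne' hj0
    · have := horb j hj
      rw [hj0, abs_zero] at this
      linarith
  have hfill : ∀ i, 1 ≤ i → (∀ y ∈ Ioo 0 v, |f^[i] y| ≠ v) → (∃ x ∈ Ioo 0 v, |f^[i] x| < v) →
      ∀ x, |x| ≤ v → |f^[i] x| ≤ v := by
    rintro i hi hne ⟨x₀, hx₀, hlt⟩ x hx
    have hc : Continuous fun x => |f^[i] x| := (hf.iterate_cont i).abs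
    rw [← hf.iterate_abs hi]
    have hx' : |x| ∈ closure (Ioo 0 v) := by
      rw [hcl]; exact ⟨abs_nonneg x, hx⟩
    refine closure_minimal (t := {x | |f^[i] x| ≤ v}) (fun y hy => ?_)
      (isClosed_le hc continuous_const) hx'
    by_contra hcon
    obtain ⟨t, ht, htv⟩ := isPreconnected_Ioo.intermediate_value hx₀ hy hc.continuousOn
      (show v ∈ Icc _ _ from ⟨hlt.le, (not_le.1 hcon).le⟩)
    exact hne t ht htv
  have hA : ∀ i, i ≤ s → ∀ j, 1 ≤ j → j < i → ∀ x ∈ Icc 0 v, v ≤ |f^[j] x| := by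
    intro i
    induction i with
    | zero => intro _ j _ hj; omega
    | succ i ih =>
      intro his j hj hji x hx
      have ih := ih (by omega)
      rcases Nat.lt_succ_iff_lt_or_eq.1 hji with k | rfl
      · exact ih j hj k x hx
      have hc : Continuous fun x => |f^[j] x| := (hf.iterate_cont j).abs
      have hBj := hB j hj ih
      rw [← hcl] at hx
      refine closure_minimal (t := {x | v ≤ |f^[j] x|}) (fun y hy => ?_)
        (isClosed_le continuous_const hc) hx
      by_contra hcon
      have hmaps := hfill j hj hBj ⟨y, hy, not_le.1 hcon⟩
      exact hmin j hj (by omega) (Filter.mem_of_superset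
        (Icc_mem_nhds (by linarith : -v < 0) hv) fun z hz => abs_le.1 (hmaps z (abs_le.2 hz)))
  have hAs := hA s le_rfl
  have hdisj : ∀ n, 1 ≤ n → n < s → ∀ x, |x| ≤ v → v ≤ |f^[n] x| := by
    intro n hn hns x hx
    rw [← hf.iterate_abs hn]
    exact hAs n hn hns |x| ⟨abs_nonneg x, hx⟩
  have hinv : ∀ x, |x| ≤ v → |f^[s] x| ≤ v := by
    have hBs := hB s hs1 hAs
    refine hfill s hs1 hBs ?_
    obtain ⟨δ, hδ, hball⟩ := Metric.mem_nhds_iff.1 hs0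
    set t := min (δ / 2) (v / 2) with ht
    have ht0 : 0 < t := lt_min (by linarith) (by linarith)
    have htv : t < v := (min_le_right _ _).trans_lt (by linarith)
    have htδ : t < δ := (min_le_left _ _).trans_lt (by linarith)
    refine ⟨t, ⟨ht0, htv⟩, lt_of_le_of_ne (abs_le.2 (hball ?_ :)) (hBs t ⟨ht0, htv⟩)⟩
    rw [Metric.mem_ball, Real.dist_eq, sub_zero, abs_of_pos ht0]
    exact htδ
  have hNs' : N = s := by
    by_contra hne
    have := hdisj N hN (by omega) x hx
    rw [hx0, abs_zero] at this
    linarith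
  subst hNs'
  exact ⟨rfl, hf, hs1, hv, hnice, hinv, hdisj, ⟨abs_nonneg x, hx⟩, by rw [hf.iterate_abs hN, hx0]⟩

/-! ### The monotone pullback and the adjacent intervals -/

namespace EvenUnimodal
variable {f : ℝ → ℝ}

theorem finite_fiber (hf : EvenUnimodal f) (n : ℕ) (y : ℝ) : {x | f^[n] x = y}.Finite := by
  induction n generalizing y with
  | zero => simp
  | succ n ih =>
    simp only [Function.iterate_succ_apply']
    by_cases h : ∃ t, f t = y
    · obtain ⟨t, rfl⟩ := h
      refine ((ih |t|).union (ih (-|t|))).subset fun x hx => ?_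
      have := (hf.eq_iff _ _).1 hx
      exact eq_or_eq_neg_of_abs_eq this
    · refine finite_empty.subset fun x hx => h ⟨_, hx⟩

/-- Since fibres are finite, a branch that is monotone is injective. -/
theorem injOn_of_isMonotoneOn (hf : EvenUnimodal f) {n : ℕ} {A : Set ℝ} (hA : A.OrdConnected)
    (hm : IsMonotoneOn f^[n] A) : InjOn f^[n] A := by
  have key : ∀ x ∈ A, ∀ y ∈ A, x < y → f^[n] x ≠ f^[n] y := by
    intro x hx y hy hxy h
    refine (Icc_infinite hxy) ((hf.finite_fiber n (f^[n] x)).subset fun t ht => ?_)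
    have htA := hA.out hx hy ht
    rcases hm with m | m
    · exact le_antisymm (h ▸ m htA hy ht.2) (m hx htA ht.1)
    · exact le_antisymm (m hx htA ht.1) (h ▸ m htA hy ht.2)
  intro x hx y hy h
  rcases lt_trichotomy x y with k | k | k
  · exact absurd h (key x hx y hy k)
  · exact k
  · exact absurd h.symm (key y hy x hx k)

/-- An injective iterate has no turning point inside its interval of injectivity: near a preimage of
the critical point it would fold. -/
theorem critFree_of_injOn (hf : EvenUnimodal f) {n : ℕ} {a b : ℝ} (h : InjOn f^[n] (Icc a b)) :
    CritFree f n a b := by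
  intro i hi x hx hx0
  have hab : a ≤ b := hx.1.le.trans hx.2.le
  have ha : a ∈ Icc a b := ⟨le_rfl, hab⟩
  have hb : b ∈ Icc a b := ⟨hab, le_rfl⟩
  obtain ⟨j, rfl⟩ : ∃ j, n = (j + 1) + i := ⟨n - i - 1, by omega⟩
  have hinj : InjOn f^[i] (Icc a b) := fun y hy z hz hyz => h hy hz (by
    rw [Function.iterate_add_apply, hyz, ← Function.iterate_add_apply])
  have hfold : ∀ y ∈ Icc a b, ∀ z ∈ Icc a b, y < z → f^[i] y ≠ -f^[i] z := by
    intro y hy z hz hyz e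
    refine hyz.ne (h hy hz ?_)
    rw [Function.iterate_add_apply, e, hf.iterate_even (by omega), ← Function.iterate_add_apply]
  have hc := (hf.iterate_cont i).continuousOn (s := Icc a b)
  have hsub : ∀ c d, a ≤ c → c ≤ d → d ≤ b → ContinuousOn f^[i] (Icc c d) := fun c d _ _ _ =>
    (hf.iterate_cont i).continuousOn
  rcases hc.strictMonoOn_of_injOn_Icc' hab hinj with m | m
  · have m1 : f^[i] a < 0 := hx0 ▸ m ha ⟨hx.1.le, hx.2.le⟩ hx.1
    have m2 : 0 < f^[i] b := hx0 ▸ m ⟨hx.1.le, hx.2.le⟩ hb hx.2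
    set η := min (-f^[i] a) (f^[i] b) with hη
    have hη0 : 0 < η := lt_min (by linarith) m2
    obtain ⟨y, hy, hyη⟩ := intermediate_value_Icc hx.1.le (hsub a x le_rfl hx.1.le hx.2.le)
      (show -η ∈ Icc _ _ from ⟨by linarith [min_le_left (-f^[i] a) (f^[i] b)], by linarith⟩)
    obtain ⟨z, hz, hzη⟩ := intermediate_value_Icc hx.2.le (hsub x b hx.1.le hx.2.le le_rfl)
      (show η ∈ Icc _ _ from ⟨by linarith, min_le_right _ _⟩)
    refine hfold y ⟨hy.1, by linarith [hy.2, hx.2]⟩ z ⟨by linarith [hz.1, hx.1], hz.2⟩ ?_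
      (by rw [hyη, hzη])
    refine lt_of_le_of_ne (hy.2.trans hz.1) fun e => ?_
    rw [e, hzη] at hyη
    linarith
  · have m1 : 0 < f^[i] a := hx0 ▸ m ha ⟨hx.1.le, hx.2.le⟩ hx.1
    have m2 : f^[i] b < 0 := hx0 ▸ m ⟨hx.1.le, hx.2.le⟩ hb hx.2
    set η := min (f^[i] a) (-f^[i] b) with hη
    have hη0 : 0 < η := lt_min m1 (by linarith)
    obtain ⟨y, hy, hyη⟩ := intermediate_value_Icc' hx.1.le (hsub a x le_rfl hx.1.le hx.2.le)
      (show η ∈ Icc _ _ from ⟨by linarith, min_le_left _ _⟩)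
    obtain ⟨z, hz, hzη⟩ := intermediate_value_Icc' hx.2.le (hsub x b hx.1.le hx.2.le le_rfl)
      (show -η ∈ Icc _ _ from ⟨by linarith [min_le_right (f^[i] a) (-f^[i] b)], by linarith⟩)
    refine hfold y ⟨hy.1, by linarith [hy.2, hx.2]⟩ z ⟨by linarith [hz.1, hx.1], hz.2⟩ ?_
      (by rw [hyη, hzη, neg_neg])
    refine lt_of_le_of_ne (hy.2.trans hz.1) fun e => ?_
    rw [e, hzη] at hyη
    linarith

/-- The monotone pullback of `[-v, v]` is a compact interval whose boundary is sent to `±v`. -/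
theorem exists_eq_Icc (hf : EvenUnimodal f) {v : ℝ} {n : ℕ} {A : Set ℝ}
    (hv : 0 < v) (hA : A.OrdConnected) (hm : IsMonotoneOn f^[n] A)
    (himg : f^[n] '' A = Icc (-v) v) :
    ∃ a b, a < b ∧ A = Icc a b ∧ |f^[n] a| = v ∧ |f^[n] b| = v ∧ CritFree f n a b := by
  obtain ⟨x, hx, hxv⟩ : -v ∈ f^[n] '' A := himg ▸ ⟨le_rfl, by linarith⟩
  obtain ⟨y, hy, hyv⟩ : v ∈ f^[n] '' A := himg ▸ ⟨by linarith, le_rfl⟩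
  have hinj := hf.injOn_of_isMonotoneOn hA hm
  have himg' : ∀ t ∈ A, -v ≤ f^[n] t ∧ f^[n] t ≤ v := fun t ht =>
    himg.subset (mem_image_of_mem _ ht)
  have hxv' : |f^[n] x| = v := by rw [hxv, abs_neg, abs_of_pos hv]
  have hyv' : |f^[n] y| = v := by rw [hyv, abs_of_pos hv]
  have hne : x ≠ y := fun e => by rw [e, hyv] at hxv; linarith
  rcases hm with m | m
  · have hxy : x < y := by
      by_contra hcon
      have := m hy hx (not_lt.1 hcon)
      linarith
    have hA' : A = Icc x y := by
      refine Subset.antisymm (fun t ht => ?_) (hA.out hx hy)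
      constructor
      · by_contra hcon
        have h1 := m ht hx (not_le.1 hcon).le
        exact (not_le.1 hcon).ne (hinj ht hx (le_antisymm h1 (hxv ▸ (himg' t ht).1)))
      · by_contra hcon
        have h1 := m hy ht (not_le.1 hcon).le
        exact (not_le.1 hcon).ne (hinj hy ht (le_antisymm h1 (hyv ▸ (himg' t ht).2)))
    exact ⟨x, y, hxy, hA', hxv', hyv', hf.critFree_of_injOn (hA' ▸ hinj)⟩
  · have hxy : y < x := by
      by_contra hcon
      have := m hx hy (not_lt.1 hcon)
      linarith
    have hA' : A = Icc y x := by
      refine Subset.antisymm (fun t ht => ?_) (hA.out hy hx)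
      constructor
      · by_contra hcon
        have h1 := m ht hy (not_le.1 hcon).le
        exact (not_le.1 hcon).ne (hinj ht hy (le_antisymm (hyv ▸ (himg' t ht).2) h1))
      · by_contra hcon
        have h1 := m hx ht (not_le.1 hcon).le
        exact (not_le.1 hcon).ne (hinj hx ht (le_antisymm (hxv ▸ (himg' t ht).1) h1))
    exact ⟨y, x, hxy, hA', hyv', hxv', hf.critFree_of_injOn (hA' ▸ hinj)⟩

end EvenUnimodal

namespace PeriodicCycle
variable {f : ℝ → ℝ} {v h : ℝ} {s : ℕ}

/-- The return map sends the boundary points of the monotone pullback to `f v`. -/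
theorem iterate_pred (H : PeriodicCycle f v h s) {x : ℝ} (hx : |f^[s - 1] x| = v) :
    f^[s] x = f v := by
  have := H.one_le
  rw [show s = s - 1 + 1 by omega, Function.iterate_succ_apply', ← H.unimodal.abs, hx]

theorem iterate_pred_f (H : PeriodicCycle f v h s) : f^[s - 1] (f h) = 0 := by
  have := H.one_le
  rw [← Function.iterate_succ_apply, Nat.succ_eq_add_one, Nat.sub_add_cancel this, H.zero]

/-- To the right of the monotone pullback, up to the next turning point, the return map increases
over a definite length. -/
theorem exists_right (H : PeriodicCycle f v h s)
    (hren : ∀ n, 2 ≤ n → s = 2 * n → CritFree f (n - 1) (f 0) (f^[n + 1] h) → False)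
    {b : ℝ} (hb : f h < b) (hF : CritFree f (s - 1) (f h) b) (hbv : |f^[s - 1] b| = v) :
    ∃ x, b < x ∧ MonotoneOn f^[s] (Icc b x) ∧ 0.6 * (f v - f 0) ≤ f^[s] x - f v := by
  have h01 := H.f_zero_lt_f_v
  have hs := H.one_le
  have hz := H.iterate_pred_f
  have hss : s - 1 + 1 = s := by omega
  set Z := {x | ∃ i < s - 1, f^[i] x = 0} ∩ Ici b with hZ
  have hZc : IsClosed Z := (H.unimodal.isClosed_exists_zero _).inter isClosed_Ici
  rcases Z.eq_empty_or_nonempty with hem | hne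
  · have hfree : ∀ M, CritFree f (s - 1) (f h) M := by
      intro M i hi x hx h0
      rcases lt_or_ge x b with k | k
      · exact hF i hi x ⟨hx.1, k⟩ h0
      · exact (eq_empty_iff_forall_notMem.1 hem x) ⟨⟨i, hi, h0⟩, k⟩
    obtain ⟨x, hx, hx'⟩ := (((H.unimodal.iterate_tendsto s).eventually_ge_atTop
      (f v + (f v - f 0))).and (eventually_gt_atTop b)).exists
    refine ⟨x, hx', ?_, by linarith⟩
    have m := (H.unimodal.strictMonoOn_of_left (hfree x) hz).monotoneOn
    rw [hss] at m
    exact m.mono (Icc_subset_Icc_left hb.le)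
  · have hZb : BddBelow Z := ⟨b, fun x hx => hx.2⟩
    obtain ⟨⟨j, hj, hj0⟩, hbe⟩ := hZc.csInf_mem hne hZb
    set e := sInf Z
    have hbe : b ≤ e := hbe
    have hfree : CritFree f (s - 1) (f h) e := by
      intro i hi x hx h0
      rcases lt_or_ge x b with k | k
      · exact hF i hi x ⟨hx.1, k⟩ h0
      · exact absurd (csInf_le hZb ⟨⟨i, hi, h0⟩, k⟩) (not_le.2 hx.2)
    have m := (H.unimodal.strictMonoOn_of_left hfree hz).monotoneOn
    rw [hss] at m
    obtain ⟨k, hk⟩ : ∃ k, s = (k + 1) + j := ⟨s - 1 - j, by omega⟩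
    have he1 : f^[j + 1] e = f 0 := by rw [Function.iterate_succ_apply', hj0]
    have hI := CritFree.image_reverse H.unimodal (n := j + 1) (j := k - 1) (hb.le.trans hbe)
      (hfree.mono (by omega) le_rfl le_rfl)
    have hidx : f^[j + 1] (f h) = f^[s - k + 1] h := by
      rw [← Function.iterate_succ_apply, show s - k + 1 = (j + 1).succ by omega]
    rw [he1, hidx] at hI
    have key := H.le_gap (by omega) (by omega) hI hren
    have hval : f^[s] e = f^[k + 1] 0 := by
      rw [hk, Function.iterate_add_apply, hj0]
    refine ⟨e, lt_of_le_of_ne hbe fun e' => ?_, m.mono (Icc_subset_Icc_left hb.le), hval ▸ key⟩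
    -- at `b` itself the return map takes the value `f v`, which the gap excludes
    rw [← hval, ← e', H.iterate_pred hbv] at key
    linarith

/-- To the left of the monotone pullback, down to the next turning point, the return map decreases
over a definite length. -/
theorem exists_left (H : PeriodicCycle f v h s)
    (hren : ∀ n, 2 ≤ n → s = 2 * n → CritFree f (n - 1) (f 0) (f^[n + 1] h) → False)
    {a : ℝ} (ha : a < f h) (hF : CritFree f (s - 1) a (f h)) (hav : |f^[s - 1] a| = v) :
    ∃ x, x < a ∧ AntitoneOn f^[s] (Icc x a) ∧ 0.6 * (f v - f 0) ≤ f^[s] x - f v := by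
  have h01 := H.f_zero_lt_f_v
  have hs := H.one_le
  have hz := H.iterate_pred_f
  have hss : s - 1 + 1 = s := by omega
  set Z := {x | ∃ i < s - 1, f^[i] x = 0} ∩ Iic a with hZ
  have hZc : IsClosed Z := (H.unimodal.isClosed_exists_zero _).inter isClosed_Iic
  rcases Z.eq_empty_or_nonempty with hem | hne
  · have hfree : ∀ M, CritFree f (s - 1) M (f h) := by
      intro M i hi x hx h0
      rcases lt_or_ge a x with k | k
      · exact hF i hi x ⟨k, hx.2⟩ h0
      · exact (eq_empty_iff_forall_notMem.1 hem x) ⟨⟨i, hi, h0⟩, k⟩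
    obtain ⟨x, hx, hx'⟩ := (((H.unimodal.iterate_tendsto s).eventually_ge_atTop
      (f v + (f v - f 0))).and (eventually_gt_atTop (-a))).exists
    refine ⟨-x, by linarith, ?_, by rw [H.unimodal.iterate_even hs]; linarith⟩
    have m := (H.unimodal.strictAntiOn_of_right (hfree (-x)) hz).antitoneOn
    rw [hss] at m
    exact m.mono (Icc_subset_Icc_right ha.le)
  · have hZb : BddAbove Z := ⟨a, fun x hx => hx.2⟩
    obtain ⟨⟨j, hj, hj0⟩, hae⟩ := hZc.csSup_mem hne hZb
    set e := sSup Z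
    have hae : e ≤ a := hae
    have hfree : CritFree f (s - 1) e (f h) := by
      intro i hi x hx h0
      rcases lt_or_ge a x with k | k
      · exact hF i hi x ⟨k, hx.2⟩ h0
      · exact absurd (le_csSup hZb ⟨⟨i, hi, h0⟩, k⟩) (not_le.2 hx.1)
    have m := (H.unimodal.strictAntiOn_of_right hfree hz).antitoneOn
    rw [hss] at m
    obtain ⟨k, hk⟩ : ∃ k, s = (k + 1) + j := ⟨s - 1 - j, by omega⟩
    have he1 : f^[j + 1] e = f 0 := by rw [Function.iterate_succ_apply', hj0]
    have hI := CritFree.image H.unimodal (n := j + 1) (j := k - 1) (hae.trans ha.le)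
      (hfree.mono (by omega) le_rfl le_rfl)
    have hidx : f^[j + 1] (f h) = f^[s - k + 1] h := by
      rw [← Function.iterate_succ_apply, show s - k + 1 = (j + 1).succ by omega]
    rw [he1, hidx] at hI
    have key := H.le_gap (by omega) (by omega) hI hren
    have hval : f^[s] e = f^[k + 1] 0 := by
      rw [hk, Function.iterate_add_apply, hj0]
    refine ⟨e, lt_of_le_of_ne hae fun e' => ?_, m.mono (Icc_subset_Icc_right ha.le), hval ▸ key⟩
    -- at `a` itself the return map takes the value `f v`, which the gap excludes
    rw [← hval, e', H.iterate_pred hav] at key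
    linarith

end PeriodicCycle

/-- A maximal interval adjacent to `[a, b]` contains every interval of monotonicity of one
of its two sides. -/
theorem IsAdjacentMonotone.subset_or_subset {g : ℝ → ℝ} {a b : ℝ} {l : Set ℝ} (hab : a < b)
    (hl : IsAdjacentMonotone g (Icc a b) l) :
    (∀ x, b < x → IsMonotoneOn g (Icc b x) → Icc b x ⊆ l) ∨
      (∀ x, x < a → IsMonotoneOn g (Icc x a) → Icc x a ⊆ l) := by
  obtain ⟨⟨hord, -, hdis, p, hp⟩, hmax⟩ := hl
  rw [interior_Icc] at hdis
  have hpl : p ∈ l ∩ Icc a b := hp ▸ mem_singleton p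
  have hnot : ∀ y ∈ l, y ∉ Ioo a b := fun y hy hy' => disjoint_left.1 hdis hy hy'
  by_cases hpb : p = b
  · left
    intro x hbx hm
    rw [hpb] at hpl
    by_cases hex : ∃ y ∈ l, x ≤ y
    · obtain ⟨y, hy, hxy⟩ := hex
      exact (Icc_subset_Icc_right hxy).trans (hord.out hpl.1 hy)
    · push Not at hex
      refine hmax (y := Icc b x) ⟨ordConnected_Icc, hm, ?_, b, ?_⟩ ?_
      · rw [interior_Icc]
        exact disjoint_left.2 fun y hy hy' => absurd hy'.2 (not_lt.2 hy.1)
      · ext y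
        simp only [mem_inter_iff, mem_Icc, mem_singleton_iff]
        exact ⟨fun k => le_antisymm k.2.2 k.1.1,
          fun k => by subst k; exact ⟨⟨le_rfl, hbx.le⟩, hab.le, le_rfl⟩⟩
      · intro y hy
        refine ⟨?_, (hex y hy).le⟩
        by_contra hcon
        push Not at hcon
        have h1 : max y ((a + b) / 2) ∈ Icc y b := ⟨le_max_left _ _, max_le hcon.le (by linarith)⟩
        exact hnot _ (hord.out hy hpl.1 h1)
          ⟨lt_max_of_lt_right (by linarith), max_lt hcon (by linarith)⟩
  · right
    have hpa : p = a := by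
      by_contra hne
      exact hnot p hpl.1 ⟨lt_of_le_of_ne hpl.2.1 (Ne.symm hne), lt_of_le_of_ne hpl.2.2 hpb⟩
    intro x hxa hm
    rw [hpa] at hpl
    by_cases hex : ∃ y ∈ l, y ≤ x
    · obtain ⟨y, hy, hxy⟩ := hex
      exact (Icc_subset_Icc_left hxy).trans (hord.out hy hpl.1)
    · push Not at hex
      refine hmax (y := Icc x a) ⟨ordConnected_Icc, hm, ?_, a, ?_⟩ ?_
      · rw [interior_Icc]
        exact disjoint_left.2 fun y hy hy' => absurd hy'.1 (not_lt.2 hy.2)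
      · ext y
        simp only [mem_inter_iff, mem_Icc, mem_singleton_iff]
        exact ⟨fun k => le_antisymm k.1.2 k.2.1,
          fun k => by subst k; exact ⟨⟨hxa.le, le_rfl⟩, le_rfl, hab.le⟩⟩
      · intro y hy
        refine ⟨(hex y hy).le, ?_⟩
        by_contra hcon
        push Not at hcon
        have h1 : min y ((a + b) / 2) ∈ Icc a y := ⟨le_min hcon.le (by linarith), min_le_left _ _⟩
        exact hnot _ (hord.out hpl.1 hy h1)
          ⟨lt_min hcon (by linarith), min_lt_of_right_lt (by linarith)⟩

theorem mainTheorem3 (ℓ : ℕ) (hℓ : 2 ≤ ℓ) (hℓ_even : Even ℓ) (c₁ : ℝ)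
    (f : ℝ → ℝ) (hf : f = unimodalMap ℓ c₁)
    (w : ℝ) (W V U Uhat l : Set ℝ) (s : ℕ)
    (hW : W = Icc (-w) w) (hw : HasNiceBoundary f w)
    (hV : V = centralDomain f W) (hU : U = centralDomain f V)
    (hhigh : HasHighReturn f W)
    (hUV : U = V) (hs : IsPeriodicInterval f V s)
    (hren : ¬ ∃ m : ℕ, s = 2 * m ∧ IsRenormalizable f m)
    (hUhat : IsMonotonePullback f s V U Uhat)
    (hl : IsAdjacentMonotone f^[s] Uhat l) :
    ENNReal.ofReal 0.6 * volume (f '' V) ≤ volume (f^[s] '' l) := by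
  have hE : EvenUnimodal f := hf ▸ evenUnimodal_unimodalMap hℓ hℓ_even c₁
  obtain ⟨hw0, hwn⟩ := hw
  obtain ⟨hVne, hVV, hVs⟩ := hs
  -- the central domain is nonempty only if the critical point returns
  have hreturn : ∀ A, (centralDomain f A).Nonempty → 0 ∈ returnSet f A := by
    intro A hA
    by_contra h0
    rw [centralDomain, connectedComponentIn_eq_empty h0, closure_empty] at hA
    exact not_nonempty_empty hA
  have h0W : 0 ∈ returnSet f (Icc (-w) w) := hW ▸ hreturn W (hV ▸ hVne)
  obtain ⟨v, hv, hvw, hcW, -, hvW⟩ := hE.exists_centralDomain_eq hw0 h0W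
  have hVI : V = Icc (-v) v := by rw [hV, hW, hcW]
  have h0V : 0 ∈ returnSet f (Icc (-v) v) := hVI ▸ hreturn V (hVV.symm ▸ hVne)
  obtain ⟨v', hv', -, hcV, hRV, -⟩ := hE.exists_centralDomain_eq hv h0V
  have hvv : v' = v := by
    rw [← hVI, hVV, hVI] at hcV
    exact ((Icc_eq_Icc_iff (by linarith)).1 hcV).2.symm
  rw [hvv] at hRV
  have hnice : ∀ n, 1 ≤ n → f^[n] v ∉ Ioo (-v) v := by
    intro n hn hin
    rcases hvw.lt_or_eq with k | k
    · refine hvW ⟨by rw [interior_Icc]; exact ⟨by linarith, k⟩, n, hn, ?_⟩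
      exact (hE.iterate_cont n).continuousAt.preimage_mem_nhds
        (Icc_mem_nhds (by linarith [hin.1]) (by linarith [hin.2]))
    · exact hwn n hn (k ▸ hin)
  rw [hVI] at hVs
  -- a high return of `W` is a zero of the return map of `V`
  have hsmem : 1 ≤ s ∧ f^[s] ⁻¹' Icc (-v) v ∈ 𝓝 (0 : ℝ) := by
    have : {n : ℕ | 1 ≤ n ∧ f^[n] ⁻¹' Icc (-v) v ∈ 𝓝 (0 : ℝ)}.Nonempty := by
      obtain ⟨-, n, hn⟩ := h0V
      exact ⟨n, hn⟩
    rw [← hVs]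
    exact Nat.sInf_mem this
  have hsW : s ∈ {n : ℕ | 1 ≤ n ∧ f^[n] ⁻¹' W ∈ 𝓝 (0 : ℝ)} :=
    ⟨hsmem.1, Filter.mem_of_superset hsmem.2
      (preimage_mono (hW ▸ Icc_subset_Icc (by linarith) hvw))⟩
  have hN1 : 1 ≤ centralTime f W := (Nat.sInf_mem ⟨s, hsW⟩).1
  have hNs : centralTime f W ≤ s := Nat.sInf_le hsW
  obtain ⟨x, hx, hx0⟩ := hhigh
  rw [hW, hcW] at hx
  obtain ⟨-, H⟩ := hE.periodicCycle hv hnice hRV hVs (abs_le.2 hx) _ hN1 hNs hx0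
  have hren' : ∀ n, 2 ≤ n → s = 2 * n → CritFree f (n - 1) (f 0) (f^[n + 1] |x|) → False := by
    rintro n hn rfl hfree
    exact hren ⟨n, rfl, H.isRenormalizable hn hfree⟩
  have h01 := H.f_zero_lt_f_v
  -- the monotone pullback
  obtain ⟨hord, hsub, hmon, himg⟩ := hUhat
  obtain ⟨a, b, hab, hUab, hav, hbv, hfree⟩ :=
    hE.exists_eq_Icc hv hord hmon (by rw [himg, hVI])
  have hz : f |x| ∈ Icc a b := by
    rw [← hUab, hE.abs]
    exact hsub ⟨x, by rw [hUV, hVI]; exact hx, rfl⟩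
  have hza : a < f |x| := lt_of_le_of_ne hz.1 fun e => by
    rw [e, H.iterate_pred_f, abs_zero] at hav
    exact hv.ne hav
  have hzb : f |x| < b := lt_of_le_of_ne hz.2 fun e => by
    rw [← e, H.iterate_pred_f, abs_zero] at hbv
    exact hv.ne hbv
  rw [hUab] at hl
  -- the image of `l` covers an interval of the required length
  obtain ⟨y, hy, hcov⟩ : ∃ y, 0.6 * (f v - f 0) ≤ y - f v ∧ Icc (f v) y ⊆ f^[s] '' l := by
    rcases hl.subset_or_subset hab with k | k
    · obtain ⟨t, hbt, hmono, hlen⟩ := H.exists_right hren' hzb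
        (hfree.mono le_rfl hza.le le_rfl) hbv
      refine ⟨f^[s] t, hlen, ?_⟩
      have := intermediate_value_Icc hbt.le (hE.iterate_cont s).continuousOn
      rw [H.iterate_pred hbv] at this
      exact this.trans (image_mono (k t hbt (Or.inl hmono)))
    · obtain ⟨t, hta, hmono, hlen⟩ := H.exists_left hren' hza
        (hfree.mono le_rfl le_rfl hzb.le) hav
      refine ⟨f^[s] t, hlen, ?_⟩
      have := intermediate_value_Icc' hta.le (hE.iterate_cont s).continuousOn
      rw [H.iterate_pred hav] at this
      exact this.trans (image_mono (k t hta (Or.inr hmono)))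
  have hvol : volume (f '' V) ≤ ENNReal.ofReal (f v - f 0) := by
    rw [← Real.volume_Icc]
    refine measure_mono ?_
    rintro _ ⟨t, ht, rfl⟩
    rw [hVI] at ht
    refine ⟨hE.min_le t, ?_⟩
    rw [← hE.abs t]
    exact hE.mono.monotoneOn (abs_nonneg t) hv.le (abs_le.2 ht)
  calc ENNReal.ofReal 0.6 * volume (f '' V)
      ≤ ENNReal.ofReal 0.6 * ENNReal.ofReal (f v - f 0) := by gcongr
    _ = ENNReal.ofReal (0.6 * (f v - f 0)) := (ENNReal.ofReal_mul (by norm_num)).symm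
    _ ≤ ENNReal.ofReal (y - f v) := ENNReal.ofReal_le_ofReal hy
    _ = volume (Icc (f v) y) := Real.volume_Icc.symm
    _ ≤ volume (f^[s] '' l) := measure_mono hcov
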